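/- Let $M$ be a smooth $n$-dimensional manifold with a smooth pseudo-Riemannian metric (a smooth, symmetric, nondegenerate scalar product $a\cdot b$ on tangent vectors, of arbitrary signature). For $p\in M$ let $GT_pM$ be the geometric (Clifford) algebra of $T_pM$, i.e. the algebra generated by $T_pM$ with $aa=a\cdot a$. A multivector field assigns to $x$ an element of $GT_xM$; it is smooth if its coefficients are smooth in the frame of wedge products $e_{j_1}\wedge\dots\wedge e_{j_k}$ ($j_1<\dots<j_k$) of coordinate vector fields $e_i$. All fields below are smooth fields defined in a neighbourhood of the point $p$ under consideration, and $\partial_a\varphi$ is the directional derivative of a scalar field. An *affine connection* $\tilde D$ assigns to each $p\in M$, each $a\in T_pM$ and each vector field $u$ near $p$ a vector $\tilde D_a u\in T_pM$ such that $\tilde D_{\alpha a+\beta b}u=\alpha\tilde D_au+\beta\tilde D_bu$ for $\alpha,\beta\in\mathbb R$, $\tilde D_a(u+v)=\tilde D_au+\tilde D_av$, and $\tilde D_a(\varphi u)=(\partial_a\varphi)u+\varphi\,\tilde D_au$ for scalar fields $\varphi$. It is *metric-compatible* if $(\tilde D_cu)\cdot v+u\cdot(\tilde D_cv)=\partial_c(u\cdot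 v)$ for all vectors $c$ and vector fields $u,v$. A *multivector directional derivative* (MDD) $D$ assigns to each $p\in M$, each $a\in T_pM$ and each multivector field $A$ near $p$ an element $D_aA\in GT_pM$ such that 1. $D_{\alpha a+\beta b}A=\alpha D_aA+\beta D_bA$ for $\alpha,\beta\in\mathbb R$; 2. $D_a\varphi=\partial_a\varphi$ for scalar fields $\varphi$; 3. $D_au\in T_pM$ for vector fields $u$; 4. $D_a(A+B)=D_aA+D_aB$; 5. $D_a(AB)=(D_aA)B+A(D_aB)$ for the geometric product. **Theorem.** Restricting an operator on multivector fields to vector fields is a bijection from the set of MDDs onto the set of metric-compatible affine connections. It is also a bijection from the set of those MDDs for which $x\mapsto D_{a(x)}A$ is smooth for all smooth $a,A$ onto the set of those metric-compatible affine connections for which $x\mapsto\tilde D_{a(x)}u$ is smooth for all smooth $a,u$. -/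

import Mathlib

open scoped Manifold ContDiff Topology

noncomputable section

namespace GeometricCalculus

/-- A smooth pseudo-Riemannian metric (of arbitrary signature) on the `n`-manifold `M`. -/
structure PseudoRiemannianMetric (n : ℕ) (M : Type*) [TopologicalSpace M]
    [ChartedSpace (EuclideanSpace ℝ (Fin n)) M] [IsManifold (𝓡 n) ∞ M] where
  /-- The scalar product `a · b` of two tangent vectors at `x`. -/
  dot (x : M) : TangentSpace (𝓡 n) x →L[ℝ] TangentSpace (𝓡 n) x →L[ℝ] ℝ
  symm (x : M) (a b : TangentSpace (𝓡 n) x) : dot x a b = dot x b a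
  nondegenerate (x : M) (a : TangentSpace (𝓡 n) x) : (∀ b, dot x a b = 0) → a = 0
  contMDiff : ContMDiff (𝓡 n)
    ((𝓡 n).prod 𝓘(ℝ, EuclideanSpace ℝ (Fin n) →L[ℝ] EuclideanSpace ℝ (Fin n) →L[ℝ] ℝ)) ∞
    (fun x ↦ Bundle.TotalSpace.mk'
      (EuclideanSpace ℝ (Fin n) →L[ℝ] EuclideanSpace ℝ (Fin n) →L[ℝ] ℝ) x (dot x))

set_option linter.unusedSectionVars false

variable {n : ℕ} {M : Type*} [TopologicalSpace M]
  [ChartedSpace (EuclideanSpace ℝ (Fin n)) M] [IsManifold (𝓡 n) ∞ M]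

namespace PseudoRiemannianMetric

variable (g : PseudoRiemannianMetric n M)

/-- The scalar product at `x` as a bilinear form. -/
def bilin (x : M) : LinearMap.BilinForm ℝ (TangentSpace (𝓡 n) x) :=
  LinearMap.mk₂ ℝ (fun a b ↦ g.dot x a b) (by simp) (by simp) (by simp) (by simp)

/-- The quadratic form `a ↦ a · a` on the tangent space at `x`. -/
def quadraticForm (x : M) : QuadraticForm ℝ (TangentSpace (𝓡 n) x) :=
  LinearMap.BilinMap.toQuadraticMap (g.bilin x)

/-- The geometric tangent space at `x`: the geometric (Clifford) algebra of the tangent space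
with the scalar product of the metric, so that `a * a = a · a` for tangent vectors `a`. -/
abbrev Multivector (x : M) : Type := CliffordAlgebra (g.quadraticForm x)

/-- A tangent vector as a multivector. -/
abbrev ofVector (x : M) : TangentSpace (𝓡 n) x →ₗ[ℝ] g.Multivector x :=
  CliffordAlgebra.ι (g.quadraticForm x)

/-- The identification of the geometric algebra with the exterior algebra, under which the wedge
product of multivectors is the product of the exterior algebra. -/
abbrev toExterior (x : M) :
    g.Multivector x ≃ₗ[ℝ] ExteriorAlgebra ℝ (TangentSpace (𝓡 n) x) :=
  CliffordAlgebra.equivExterior (g.quadraticForm x)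

/-- The grade one part of a multivector, as a tangent vector. -/
def vectorPart (x : M) (A : g.Multivector x) : TangentSpace (𝓡 n) x :=
  ExteriorAlgebra.ιInv (g.toExterior x A)

theorem vectorPart_ofVector (x : M) (a : TangentSpace (𝓡 n) x) :
    g.vectorPart x (g.ofVector x a) = a := by
  have h : g.toExterior x (g.ofVector x a) = ExteriorAlgebra.ι ℝ a :=
    CliffordAlgebra.changeForm_ι CliffordAlgebra.changeForm.associated_neg_proof a
  rw [vectorPart, h]
  exact ExteriorAlgebra.ι_leftInverse a

end PseudoRiemannianMetric

/-- The coordinate vector fields `e(x_i)` of the preferred chart at `p` (the tangent bundle is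
trivialized near `p` by the derivative of that chart). Outside of the chart domain they are `0`. -/
def coordFrame (p : M) (i : Fin n) (x : M) : TangentSpace (𝓡 n) x :=
  (trivializationAt (EuclideanSpace ℝ (Fin n)) (TangentSpace (𝓡 n)) p).localFrame
    (EuclideanSpace.basisFun (Fin n) ℝ).toBasis i x

/-- The canonical multivector frame: the wedge product `e(x_{j₁}) ∧ ⋯ ∧ e(x_{jₖ})` of the
coordinate vector fields with indices `j₁ < ⋯ < jₖ` in `J`. -/
def coordBlade (g : PseudoRiemannianMetric n M) (p : M) (J : Finset (Fin n)) (x : M) :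
    g.Multivector x :=
  (g.toExterior x).symm
    (ExteriorAlgebra.ιMulti ℝ J.card fun k ↦ coordFrame p (J.orderEmbOfFin rfl k) x)

/-- A scalar field is smooth in a neighbourhood of `p`. -/
def SmoothScalarNear (p : M) (φ : M → ℝ) : Prop :=
  ∀ᶠ x in 𝓝 p, ContMDiffAt (𝓡 n) 𝓘(ℝ, ℝ) ∞ φ x

/-- A vector field is smooth in a neighbourhood of `p`. -/
def SmoothVectorNear (p : M) (u : (x : M) → TangentSpace (𝓡 n) x) : Prop :=
  ∀ᶠ x in 𝓝 p, ContMDiffAt (𝓡 n) (𝓡 n).tangent ∞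
    (fun y ↦ (⟨y, u y⟩ : TangentBundle (𝓡 n) M)) x

/-- A multivector field is smooth in a neighbourhood of `p`: its coefficients in the canonical
multivector frame of a coordinate system around `p` are smooth. -/
def SmoothMultivectorNear (g : PseudoRiemannianMetric n M) (p : M)
    (A : (x : M) → g.Multivector x) : Prop :=
  ∃ f : Finset (Fin n) → M → ℝ, (∀ J, SmoothScalarNear (n := n) p (f J)) ∧
    ∀ᶠ x in 𝓝 p, A x = ∑ J, f J x • coordBlade g p J x

section Closure

variable {p : M}

theorem SmoothScalarNear.const (c : ℝ) : SmoothScalarNear (n := n) p (fun _ ↦ c) :=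
  Filter.Eventually.of_forall fun _ ↦ contMDiffAt_const

theorem SmoothScalarNear.add {φ ψ : M → ℝ} (hφ : SmoothScalarNear (n := n) p φ)
    (hψ : SmoothScalarNear (n := n) p ψ) :
    SmoothScalarNear (n := n) p (fun x ↦ φ x + ψ x) := by
  filter_upwards [hφ, hψ] with x h₁ h₂ using h₁.add h₂

theorem SmoothScalarNear.mul {φ ψ : M → ℝ} (hφ : SmoothScalarNear (n := n) p φ)
    (hψ : SmoothScalarNear (n := n) p ψ) :
    SmoothScalarNear (n := n) p (fun x ↦ φ x * ψ x) := by
  filter_upwards [hφ, hψ] with x h₁ h₂ using h₁.mul h₂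

theorem SmoothVectorNear.add {u v : (x : M) → TangentSpace (𝓡 n) x}
    (hu : SmoothVectorNear p u) (hv : SmoothVectorNear p v) : SmoothVectorNear p (u + v) := by
  filter_upwards [hu, hv] with x h₁ h₂ using ContMDiffAt.add_section h₁ h₂

theorem SmoothVectorNear.smul {φ : M → ℝ} {u : (x : M) → TangentSpace (𝓡 n) x}
    (hφ : SmoothScalarNear (n := n) p φ) (hu : SmoothVectorNear p u) :
    SmoothVectorNear p (fun x ↦ φ x • u x) := by
  filter_upwards [hφ, hu] with x h₁ h₂ using ContMDiffAt.smul_section h₁ h₂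

theorem SmoothVectorNear.zero :
    SmoothVectorNear p (0 : (x : M) → TangentSpace (𝓡 n) x) :=
  Filter.Eventually.of_forall fun _ ↦
    (Bundle.contMDiff_zeroSection ℝ (TangentSpace (𝓡 n) : M → Type _)).contMDiffAt

theorem SmoothVectorNear.coordFrame (i : Fin n) : SmoothVectorNear p (coordFrame p i) := by
  filter_upwards [(trivializationAt (EuclideanSpace ℝ (Fin n)) (TangentSpace (𝓡 n))
    p).open_baseSet.mem_nhds (FiberBundle.mem_baseSet_trivializationAt' p)] with x hx
  exact contMDiffAt_localFrame_of_mem (I := 𝓡 n) ∞ _ _ i hx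

theorem SmoothVectorNear.dot (g : PseudoRiemannianMetric n M)
    {u v : (x : M) → TangentSpace (𝓡 n) x}
    (hu : SmoothVectorNear p u) (hv : SmoothVectorNear p v) :
    SmoothScalarNear (n := n) p (fun x ↦ g.dot x (u x) (v x)) := by
  filter_upwards [hu, hv] with x h₁ h₂
  have h : ContMDiffAt (𝓡 n) ((𝓡 n).prod 𝓘(ℝ)) ∞
      (fun m ↦ Bundle.TotalSpace.mk' ℝ (E := Bundle.Trivial M ℝ) m (g.dot m (u m) (v m))) x := by
    apply ContMDiffAt.clm_bundle_apply₂ (F₁ := EuclideanSpace ℝ (Fin n))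
      (F₂ := EuclideanSpace ℝ (Fin n))
    · exact g.contMDiff.contMDiffAt
    · exact h₁
    · exact h₂
  simp only [Bundle.contMDiffAt_totalSpace] at h
  exact h.2

variable {g : PseudoRiemannianMetric n M}

theorem SmoothMultivectorNear.congr {A B : (x : M) → g.Multivector x}
    (hA : SmoothMultivectorNear g p A) (h : ∀ᶠ x in 𝓝 p, B x = A x) :
    SmoothMultivectorNear g p B := by
  obtain ⟨f, hf, hA⟩ := hA
  exact ⟨f, hf, by filter_upwards [hA, h] with x h₁ h₂ using h₂.trans h₁⟩

theorem SmoothMultivectorNear.add {A B : (x : M) → g.Multivector x}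
    (hA : SmoothMultivectorNear g p A) (hB : SmoothMultivectorNear g p B) :
    SmoothMultivectorNear g p (fun x ↦ A x + B x) := by
  obtain ⟨f, hf, hA⟩ := hA
  obtain ⟨f', hf', hB⟩ := hB
  refine ⟨fun J x ↦ f J x + f' J x, fun J ↦ (hf J).add (hf' J), ?_⟩
  filter_upwards [hA, hB] with x h₁ h₂
  simp only [h₁, h₂, add_smul, Finset.sum_add_distrib]

theorem SmoothMultivectorNear.smul {φ : M → ℝ} {A : (x : M) → g.Multivector x}
    (hφ : SmoothScalarNear (n := n) p φ) (hA : SmoothMultivectorNear g p A) :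
    SmoothMultivectorNear g p (fun x ↦ φ x • A x) := by
  obtain ⟨f, hf, hA⟩ := hA
  refine ⟨fun J x ↦ φ x * f J x, fun J ↦ hφ.mul (hf J), ?_⟩
  filter_upwards [hA] with x h₁
  simp only [h₁, Finset.smul_sum, mul_smul]

theorem SmoothMultivectorNear.zero :
    SmoothMultivectorNear g p (fun _ ↦ 0) :=
  ⟨fun _ _ ↦ 0, fun _ ↦ .const 0, by simp⟩

theorem SmoothMultivectorNear.sum {ι : Type*} (s : Finset ι)
    {A : ι → (x : M) → g.Multivector x} (hA : ∀ i ∈ s, SmoothMultivectorNear g p (A i)) :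
    SmoothMultivectorNear g p (fun x ↦ ∑ i ∈ s, A i x) := by
  classical
  induction s using Finset.induction_on with
  | empty => simpa using SmoothMultivectorNear.zero
  | insert i s hi ih =>
    simp only [Finset.sum_insert hi]
    exact (hA i (by simp)).add (ih fun j hj ↦ hA j (by simp [hj]))

/-- The wedge product of the coordinate vector fields along an arbitrary list of indices. -/
def coordWord (g : PseudoRiemannianMetric n M) (p : M) (l : List (Fin n)) (x : M) :
    g.Multivector x :=
  (g.toExterior x).symm (l.map fun i ↦ ExteriorAlgebra.ι ℝ (coordFrame p i x)).prod

theorem coordBlade_eq_coordWord (J : Finset (Fin n)) (x : M) :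
    coordBlade g p J x = coordWord g p (List.ofFn (J.orderEmbOfFin rfl)) x := by
  simp only [coordBlade, coordWord, ExteriorAlgebra.ιMulti_apply, List.map_ofFn]
  rfl

theorem SmoothMultivectorNear.coordBlade (J : Finset (Fin n)) :
    SmoothMultivectorNear g p (coordBlade g p J) := by
  classical
  refine ⟨fun K _ ↦ if K = J then 1 else 0, fun K ↦ .const _, ?_⟩
  simp

theorem SmoothMultivectorNear.coordWord (l : List (Fin n)) :
    SmoothMultivectorNear g p (coordWord g p l) := by
  let b := (Pi.basisFun ℝ (Fin n))
  let w := (l.map fun i ↦ ExteriorAlgebra.ι ℝ (b i)).prod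
  refine ⟨fun J _ ↦ b.ExteriorAlgebra.repr w J, fun J ↦ .const _, .of_forall fun x ↦ ?_⟩
  let f : (Fin n → ℝ) →ₗ[ℝ] TangentSpace (𝓡 n) x :=
    b.constr ℝ fun i ↦ GeometricCalculus.coordFrame p i x
  have hf (i : Fin n) : f (b i) = GeometricCalculus.coordFrame p i x := b.constr_basis ℝ _ i
  have hw : (l.map fun i ↦ ExteriorAlgebra.ι ℝ (GeometricCalculus.coordFrame p i x)).prod =
      ExteriorAlgebra.map f w := by
    simp only [w, map_list_prod, List.map_map]
    congr 2
    ext i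
    simp [hf]
  have hb (J : Finset (Fin n)) : ExteriorAlgebra.map f (b.ExteriorAlgebra J) =
      ExteriorAlgebra.ιMulti ℝ J.card
        fun k ↦ GeometricCalculus.coordFrame p (J.orderEmbOfFin rfl k) x := by
    rw [ExteriorAlgebra.basis_apply_ofCard b rfl, ExteriorAlgebra.map_apply_ιMulti]
    congr 1
    ext1 k
    exact hf _
  simp only [GeometricCalculus.coordWord, GeometricCalculus.coordBlade, ← map_smul, ← map_sum, hw,
    ← hb]
  rw [b.ExteriorAlgebra.sum_repr]

theorem toExterior_ofVector_mul (x : M) (a : TangentSpace (𝓡 n) x) (A : g.Multivector x) :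
    g.ofVector x a * A = (g.toExterior x).symm (ExteriorAlgebra.ι ℝ a * g.toExterior x A) +
      CliffordAlgebra.contractLeft (g.bilin x a) A := by
  have hB : QuadraticMap.associated (R := ℝ) (-g.quadraticForm x) a = -g.bilin x a := by
    ext b
    simp [QuadraticMap.associated_apply, PseudoRiemannianMetric.quadraticForm,
      PseudoRiemannianMetric.bilin, g.symm x b a]
    ring
  apply (g.toExterior x).injective
  rw [map_add, LinearEquiv.apply_symm_apply]
  simp only [PseudoRiemannianMetric.toExterior, CliffordAlgebra.equivExterior,
    CliffordAlgebra.changeFormEquiv_apply, PseudoRiemannianMetric.ofVector]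
  rw [CliffordAlgebra.changeForm_ι_mul, CliffordAlgebra.changeForm_contractLeft, hB]
  simp [sub_neg_eq_add]

theorem coordWord_cons (i : Fin n) (l : List (Fin n)) (x : M) :
    coordWord g p (i :: l) x = g.ofVector x (coordFrame p i x) * coordWord g p l x -
      CliffordAlgebra.contractLeft (g.bilin x (coordFrame p i x)) (coordWord g p l x) := by
  rw [toExterior_ofVector_mul, add_sub_cancel_right]
  simp only [coordWord, LinearEquiv.apply_symm_apply, List.map_cons, List.prod_cons]

/-- The multivector fields generated near `p` by smooth scalar fields and Clifford products of
coordinate vector fields; they turn out to be exactly the smooth ones. -/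
inductive Generated (g : PseudoRiemannianMetric n M) (p : M) :
    ((x : M) → g.Multivector x) → Prop
  | one : Generated g p (fun _ ↦ 1)
  | mul (i : Fin n) {A : (x : M) → g.Multivector x} : Generated g p A →
      Generated g p (fun x ↦ g.ofVector x (coordFrame p i x) * A x)
  | add {A B : (x : M) → g.Multivector x} : Generated g p A → Generated g p B →
      Generated g p (fun x ↦ A x + B x)
  | smul {φ : M → ℝ} {A : (x : M) → g.Multivector x} : SmoothScalarNear (n := n) p φ →
      Generated g p A → Generated g p (fun x ↦ φ x • A x)
  | congr {A B : (x : M) → g.Multivector x} : Generated g p A → (∀ᶠ x in 𝓝 p, B x = A x) →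
      Generated g p B

theorem Generated.sub {A B : (x : M) → g.Multivector x} (hA : Generated g p A)
    (hB : Generated g p B) : Generated g p (fun x ↦ A x - B x) :=
  (hA.add (hB.smul (SmoothScalarNear.const (-1)))).congr
    (.of_forall fun x ↦ by simp [sub_eq_add_neg])

theorem Generated.sum {ι : Type*} (s : Finset ι)
    {A : ι → (x : M) → g.Multivector x} (hA : ∀ i ∈ s, Generated g p (A i)) :
    Generated g p (fun x ↦ ∑ i ∈ s, A i x) := by
  classical
  induction s using Finset.induction_on with
  | empty => exact (Generated.one.smul (SmoothScalarNear.const 0)).congr (by simp)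
  | insert i s hi ih =>
    simp only [Finset.sum_insert hi]
    exact (hA i (by simp)).add (ih fun j hj ↦ hA j (by simp [hj]))

theorem Generated.contract (i : Fin n) {A : (x : M) → g.Multivector x} (hA : Generated g p A) :
    Generated g p (fun x ↦
      CliffordAlgebra.contractLeft (g.bilin x (coordFrame p i x)) (A x)) := by
  induction hA with
  | one => exact (Generated.one.smul (SmoothScalarNear.const 0)).congr (by simp)
  | mul j hA ih =>
    simp only [CliffordAlgebra.contractLeft_ι_mul]
    exact (hA.smul (SmoothVectorNear.dot g (.coordFrame i) (.coordFrame j))).sub (ih.mul j)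
  | add _ _ ih ih' => simpa only [map_add] using ih.add ih'
  | smul hφ _ ih => simpa only [map_smul] using ih.smul hφ
  | congr _ h ih => exact ih.congr (by filter_upwards [h] with x hx using by rw [hx])

theorem Generated.mul' {A B : (x : M) → g.Multivector x} (hA : Generated g p A)
    (hB : Generated g p B) : Generated g p (fun x ↦ A x * B x) := by
  induction hA with
  | one => simpa only [one_mul] using hB
  | mul j _ ih => simpa only [mul_assoc] using ih.mul j
  | add _ _ ih ih' => simpa only [add_mul] using ih.add ih'
  | smul hφ _ ih => simpa only [smul_mul_assoc] using ih.smul hφ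
  | congr _ h ih => exact ih.congr (by filter_upwards [h] with x hx using by rw [hx])

theorem Generated.coordWord (l : List (Fin n)) : Generated g p (coordWord g p l) := by
  induction l with
  | nil =>
    refine Generated.one.congr (.of_forall fun x ↦ ?_)
    apply (g.toExterior x).injective
    simp [GeometricCalculus.coordWord]
  | cons i l ih =>
    exact ((ih.mul i).sub (ih.contract i)).congr (.of_forall fun x ↦ coordWord_cons i l x)

theorem SmoothMultivectorNear.generated {A : (x : M) → g.Multivector x}
    (hA : SmoothMultivectorNear g p A) : Generated g p A := by
  obtain ⟨f, hf, hA⟩ := hA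
  refine (Generated.sum Finset.univ fun J _ ↦ ?_).congr hA
  simp only [coordBlade_eq_coordWord]
  exact (Generated.coordWord _).smul (hf J)

theorem SmoothMultivectorNear.wedge_coordFrame (i : Fin n) {A : (x : M) → g.Multivector x}
    (hA : SmoothMultivectorNear g p A) :
    SmoothMultivectorNear g p (fun x ↦ (g.toExterior x).symm
      (ExteriorAlgebra.ι ℝ (GeometricCalculus.coordFrame p i x) * g.toExterior x (A x))) := by
  obtain ⟨f, hf, hA⟩ := hA
  have h (J : Finset (Fin n)) : SmoothMultivectorNear g p (fun x ↦ f J x •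
      GeometricCalculus.coordWord g p (i :: List.ofFn (J.orderEmbOfFin rfl)) x) :=
    (SmoothMultivectorNear.coordWord _).smul (hf J)
  refine (SmoothMultivectorNear.sum Finset.univ fun J _ ↦ h J).congr ?_
  filter_upwards [hA] with x hx
  simp only [hx, coordBlade_eq_coordWord, GeometricCalculus.coordWord, map_sum, map_smul,
    Finset.mul_sum, mul_smul_comm, LinearEquiv.apply_symm_apply, List.map_cons, List.prod_cons]

theorem SmoothMultivectorNear.contract_coordWord (i : Fin n) (l : List (Fin n)) :
    SmoothMultivectorNear g p (fun x ↦
      CliffordAlgebra.contractLeft (g.bilin x (GeometricCalculus.coordFrame p i x))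
        (GeometricCalculus.coordWord g p l x)) := by
  have hc (x : M) (d : Module.Dual ℝ (TangentSpace (𝓡 n) x)) (A : g.Multivector x) :
      g.toExterior x (CliffordAlgebra.contractLeft d A) =
        CliffordAlgebra.contractLeft d (g.toExterior x A) :=
    
    CliffordAlgebra.changeForm_contractLeft CliffordAlgebra.changeForm.associated_neg_proof d A
  induction l with
  | nil =>
    refine SmoothMultivectorNear.zero.congr (.of_forall fun x ↦ ?_)
    apply (g.toExterior x).injective
    rw [hc]
    simp only [GeometricCalculus.coordWord, LinearEquiv.apply_symm_apply, List.map_nil,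
      List.prod_nil, map_zero]
    exact CliffordAlgebra.contractLeft_one
      (Q := (0 : QuadraticForm ℝ (TangentSpace (𝓡 n) x))) _
  | cons j l ih =>
    have h₁ := (SmoothMultivectorNear.coordWord (g := g) l).smul
      (SmoothVectorNear.dot g (.coordFrame i) (.coordFrame (p := p) j))
    have h₂ := (ih.wedge_coordFrame j).smul (SmoothScalarNear.const (-1))
    refine (h₁.add h₂).congr (.of_forall fun x ↦ ?_)
    apply (g.toExterior x).injective
    rw [hc, map_add, map_smul, map_smul, LinearEquiv.apply_symm_apply, hc]
    simp only [GeometricCalculus.coordWord, LinearEquiv.apply_symm_apply, List.map_cons,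
      List.prod_cons, neg_smul, one_smul, ← sub_eq_add_neg]
    exact CliffordAlgebra.contractLeft_ι_mul
      (Q := (0 : QuadraticForm ℝ (TangentSpace (𝓡 n) x))) _ _ _

theorem SmoothMultivectorNear.ofVector_coordFrame_mul (i : Fin n)
    {A : (x : M) → g.Multivector x} (hA : SmoothMultivectorNear g p A) :
    SmoothMultivectorNear g p (fun x ↦ g.ofVector x (GeometricCalculus.coordFrame p i x) * A x) := by
  obtain ⟨f, hf, hA⟩ := hA
  have h (J : Finset (Fin n)) : SmoothMultivectorNear g p (fun x ↦ f J x •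
      (GeometricCalculus.coordWord g p (i :: List.ofFn (J.orderEmbOfFin rfl)) x +
        CliffordAlgebra.contractLeft (g.bilin x (GeometricCalculus.coordFrame p i x))
          (GeometricCalculus.coordWord g p (List.ofFn (J.orderEmbOfFin rfl)) x))) :=
    ((SmoothMultivectorNear.coordWord _).add (.contract_coordWord i _)).smul (hf J)
  refine (SmoothMultivectorNear.sum Finset.univ fun J _ ↦ h J).congr ?_
  filter_upwards [hA] with x hx
  simp only [hx, coordBlade_eq_coordWord, coordWord_cons, Finset.mul_sum, mul_smul_comm,
    sub_add_cancel]

theorem Generated.smooth {A : (x : M) → g.Multivector x} (hA : Generated g p A) :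
    SmoothMultivectorNear g p A := by
  induction hA with
  | one =>
    refine (SmoothMultivectorNear.coordWord []).congr (.of_forall fun x ↦ ?_)
    apply (g.toExterior x).injective
    simp [GeometricCalculus.coordWord]
  | mul i _ ih => exact ih.ofVector_coordFrame_mul i
  | add _ _ ih ih' => exact ih.add ih'
  | smul hφ _ ih => exact ih.smul hφ
  | congr _ h ih => exact ih.congr h

theorem SmoothMultivectorNear.mul {A B : (x : M) → g.Multivector x}
    (hA : SmoothMultivectorNear g p A) (hB : SmoothMultivectorNear g p B) :
    SmoothMultivectorNear g p (fun x ↦ A x * B x) :=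
  (hA.generated.mul' hB.generated).smooth

theorem SmoothScalarNear.toMultivector {φ : M → ℝ} (hφ : SmoothScalarNear (n := n) p φ) :
    SmoothMultivectorNear g p (fun x ↦ algebraMap ℝ (g.Multivector x) (φ x)) :=
  ((Generated.one.smul hφ).congr
    (.of_forall fun x ↦ by rw [Algebra.algebraMap_eq_smul_one])).smooth

theorem SmoothVectorNear.toMultivector {u : (x : M) → TangentSpace (𝓡 n) x}
    (hu : SmoothVectorNear p u) : SmoothMultivectorNear g p (fun x ↦ g.ofVector x (u x)) := by
  let e := trivializationAt (EuclideanSpace ℝ (Fin n)) (TangentSpace (𝓡 n) : M → Type _) p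
  let b := (EuclideanSpace.basisFun (Fin n) ℝ).toBasis
  have he := FiberBundle.mem_baseSet_trivializationAt' (F := EuclideanSpace ℝ (Fin n))
    (E := (TangentSpace (𝓡 n) : M → Type _)) p
  have hf (i : Fin n) : SmoothScalarNear (n := n) p
      (fun x ↦ e.localFrameCoeff (𝓡 n) b i x (u x)) := by
    filter_upwards [e.open_baseSet.mem_nhds he, hu] with x hx hux
    exact contMDiffAt_localFrameCoeff b hx hux i
  have h (i : Fin n) : Generated g p (fun x ↦ e.localFrameCoeff (𝓡 n) b i x (u x) •
      (g.ofVector x (GeometricCalculus.coordFrame p i x) * 1)) := (Generated.one.mul i).smul (hf i)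
  refine ((Generated.sum Finset.univ fun i _ ↦ h i).congr ?_).smooth
  filter_upwards [e.eventually_eq_localFrame_sum_coeff_smul (I := 𝓡 n) b he (s := u)] with x hx
  conv_lhs => rw [hx]
  simp only [map_sum, map_smul, mul_one]
  rfl

end Closure

section Operators

/-- The space of vector fields that are smooth in a neighbourhood of `p`. A local field is
represented by an arbitrary extension to `M`; its values away from `p` are irrelevant. -/
def smoothVectorFields (p : M) : Submodule ℝ ((x : M) → TangentSpace (𝓡 n) x) where
  carrier := {u | SmoothVectorNear p u}
  zero_mem' := .zero
  add_mem' := .add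
  smul_mem' c _ hu := hu.smul (φ := fun _ ↦ c) (.const c)

/-- The algebra, under the geometric product, of multivector fields that are smooth in a
neighbourhood of `p`. -/
def smoothMultivectorFields (g : PseudoRiemannianMetric n M) (p : M) :
    Subalgebra ℝ ((x : M) → g.Multivector x) where
  carrier := {A | SmoothMultivectorNear g p A}
  mul_mem' := .mul
  add_mem' := .add
  algebraMap_mem' c := (SmoothScalarNear.const c).toMultivector

/-- The multiple `φ u` of a vector field by a scalar field. -/
def scalarMul {p : M} (φ : M → ℝ) (hφ : SmoothScalarNear (n := n) p φ)
    (u : smoothVectorFields (n := n) p) : smoothVectorFields (n := n) p :=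
  ⟨fun x ↦ φ x • u.1 x, SmoothVectorNear.smul hφ u.2⟩

/-- A scalar field as a multivector field. -/
def scalarField (g : PseudoRiemannianMetric n M) {p : M} (φ : M → ℝ)
    (hφ : SmoothScalarNear (n := n) p φ) : smoothMultivectorFields g p :=
  ⟨fun x ↦ algebraMap ℝ (g.Multivector x) (φ x), hφ.toMultivector⟩

/-- A vector field as a multivector field. -/
def vectorField (g : PseudoRiemannianMetric n M) {p : M} (u : smoothVectorFields (n := n) p) :
    smoothMultivectorFields g p :=
  ⟨fun x ↦ g.ofVector x (u.1 x), SmoothVectorNear.toMultivector u.2⟩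

/-- The directional derivative `∂_a φ` of a scalar field. -/
def scalarDeriv {p : M} (a : TangentSpace (𝓡 n) p) (φ : M → ℝ) : ℝ :=
  mvfderiv (𝓡 n) φ p a

/-- Operators mapping a tangent vector at `p` and a vector field that is smooth near `p` to a
tangent vector at `p`. -/
abbrev VectorOperator (n : ℕ) (M : Type*) [TopologicalSpace M]
    [ChartedSpace (EuclideanSpace ℝ (Fin n)) M] [IsManifold (𝓡 n) ∞ M] : Type _ :=
  (p : M) → TangentSpace (𝓡 n) p → smoothVectorFields (n := n) p → TangentSpace (𝓡 n) p

/-- Operators mapping a tangent vector at `p` and a multivector field that is smooth near `p` to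
a tangent multivector at `p`. -/
abbrev MultivectorOperator (g : PseudoRiemannianMetric n M) : Type _ :=
  (p : M) → TangentSpace (𝓡 n) p → smoothMultivectorFields g p → g.Multivector p

/-- Affine connections. -/
structure IsAffineConnection (D : VectorOperator n M) : Prop where
  linear_direction (p : M) (a b : TangentSpace (𝓡 n) p) (α β : ℝ)
    (u : smoothVectorFields (n := n) p) : D p (α • a + β • b) u = α • D p a u + β • D p b u
  add (p : M) (a : TangentSpace (𝓡 n) p) (u v : smoothVectorFields (n := n) p) :
    D p a (u + v) = D p a u + D p a v
  scalar_mul (p : M) (a : TangentSpace (𝓡 n) p) (φ : M → ℝ)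
    (hφ : SmoothScalarNear (n := n) p φ) (u : smoothVectorFields (n := n) p) :
    D p a (scalarMul φ hφ u) = scalarDeriv a φ • u.1 p + φ p • D p a u

/-- Metric-compatibility: `(D_c a) · b + a · (D_c b) = ∂_c (a · b)`. -/
def IsMetricCompatible (g : PseudoRiemannianMetric n M) (D : VectorOperator n M) : Prop :=
  ∀ (p : M) (c : TangentSpace (𝓡 n) p) (a b : smoothVectorFields (n := n) p),
    g.dot p (D p c a) (b.1 p) + g.dot p (a.1 p) (D p c b) =
      scalarDeriv c fun x ↦ g.dot x (a.1 x) (b.1 x)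

/-- Multivector directional derivatives: the operators which are linear in the direction, agree
with the directional derivative on scalar fields, map vector fields to vectors, are additive, and
satisfy the product rule for the geometric product. -/
structure IsMDD (g : PseudoRiemannianMetric n M) (D : MultivectorOperator g) : Prop where
  linear_direction (p : M) (a b : TangentSpace (𝓡 n) p) (α β : ℝ)
    (A : smoothMultivectorFields g p) : D p (α • a + β • b) A = α • D p a A + β • D p b A
  scalar (p : M) (a : TangentSpace (𝓡 n) p) (φ : M → ℝ)
    (hφ : SmoothScalarNear (n := n) p φ) :
    D p a (scalarField g φ hφ) = algebraMap ℝ (g.Multivector p) (scalarDeriv a φ)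
  vector (p : M) (a : TangentSpace (𝓡 n) p) (u : smoothVectorFields (n := n) p) :
    g.ofVector p (g.vectorPart p (D p a (vectorField g u))) = D p a (vectorField g u)
  add (p : M) (a : TangentSpace (𝓡 n) p) (A B : smoothMultivectorFields g p) :
    D p a (A + B) = D p a A + D p a B
  mul (p : M) (a : TangentSpace (𝓡 n) p) (A B : smoothMultivectorFields g p) :
    D p a (A * B) = D p a A * B.1 p + A.1 p * D p a B

/-- The restriction of an operator on multivector fields to vector fields. The result is read as
a tangent vector; for operators which map vector fields to vectors nothing is discarded. -/
def restrictToVectors (g : PseudoRiemannianMetric n M) (D : MultivectorOperator g) :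
    VectorOperator n M :=
  fun p a u ↦ g.vectorPart p (D p a (vectorField g u))

/-- For smooth vector fields `a`, `u` the field `x ↦ D_{a(x)} u` is smooth. -/
def VectorOperator.IsSmooth (D : VectorOperator n M) : Prop :=
  ∀ (p : M) (a u : smoothVectorFields (n := n) p), ∃ v : smoothVectorFields (n := n) p,
    ∀ᶠ x in 𝓝 p, ∃ hu : u.1 ∈ smoothVectorFields (n := n) x, D x (a.1 x) ⟨u.1, hu⟩ = v.1 x

/-- For smooth vector fields `a` and multivector fields `A` the field `x ↦ D_{a(x)} A` is
smooth. -/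
def MultivectorOperator.IsSmooth {g : PseudoRiemannianMetric n M}
    (D : MultivectorOperator g) : Prop :=
  ∀ (p : M) (a : smoothVectorFields (n := n) p) (A : smoothMultivectorFields g p),
    ∃ B : smoothMultivectorFields g p, ∀ᶠ x in 𝓝 p,
      ∃ hA : A.1 ∈ smoothMultivectorFields g x, D x (a.1 x) ⟨A.1, hA⟩ = B.1 x

end Operators

end GeometricCalculus

end

open GeometricCalculus

open scoped Manifold ContDiff Topology

noncomputable section

/-! An MDD restricts to a connection because the vector-valued axiom keeps it inside the tangent
spaces. The connection is metric-compatible because differentiating `uv + vu = 2 u·v` with the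
product rule leaves exactly the compatibility identity.

Injectivity and the passage of smoothness from vectors to multivectors rest on one fact: near a
point, smooth multivector fields are generated by `1` under left Clifford multiplication by
coordinate vector fields, smooth scalar multiples, sums and local modification
(`SmoothMultivectorNear.generated`). Each generating step is governed by an MDD rule, so values on
vector fields determine everything (`IsMDD.eq_of_restrict_eq`, `IsMDD.isSmooth_of_restrict`).

Surjectivity is the real construction. Wedge products of coordinate fields form a frame for any
metric, so a field near `p` can be read as a function into the fixed exterior algebra of the tangent
space at `p`. Define `D_a A` as the derivative of that function at `p` plus `δ A`, where `δ` is the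
derivation of the exterior algebra extending the map `Γ : e_i ↦ D_a e_i`. No relation has to be
checked for this to be well defined; the price is that the product rule is stated for the Clifford
product. By the generation fact it suffices to treat left multiplication by `e_i`, which is wedging
with `e_i` plus contraction by the form `e_i·`. The wedge part is harmless. In the contraction part,
differentiating the metric coefficients contributes the form `(Γ e_i)· + (e_i·) ∘ Γ` by metric
compatibility, while commuting `δ` past the contraction contributes minus the second summand
(`exteriorDerivation_contract`). What remains is the Clifford product with `Γ e_i`, as required
(`isFrameDerivation_frameDerivation`). -/

namespace GeometricCalculus

/-! ### Derivations and contractions of the exterior algebra -/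

section ExteriorDerivation

variable {V W : Type*} [AddCommGroup V] [Module ℝ V] [AddCommGroup W] [Module ℝ W]

/-- The algebra homomorphism `A ↦ A + ε δ A` into the dual numbers over the exterior algebra, where
`δ` is the derivation which extends the linear map `f`. -/
def exteriorDualHom (f : V →ₗ[ℝ] V) : ExteriorAlgebra ℝ V →ₐ[ℝ]
    TrivSqZeroExt (ExteriorAlgebra ℝ V) (ExteriorAlgebra ℝ V) :=
  ExteriorAlgebra.lift ℝ
    ⟨(TrivSqZeroExt.inlAlgHom ℝ (ExteriorAlgebra ℝ V) (ExteriorAlgebra ℝ V)).toLinearMap ∘ₗ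
        ExteriorAlgebra.ι ℝ +
      (TrivSqZeroExt.inrHom (ExteriorAlgebra ℝ V) (ExteriorAlgebra ℝ V)).restrictScalars ℝ ∘ₗ
        ExteriorAlgebra.ι ℝ ∘ₗ f, fun v ↦ by
      ext
      · simp
      -- The `ε`-part of the square is `v ∧ f v + f v ∧ v`, which vanishes by anticommutativity.
      · simp [ExteriorAlgebra.ι_add_mul_swap]⟩

theorem exteriorDualHom_ι (f : V →ₗ[ℝ] V) (v : V) :
    exteriorDualHom f (ExteriorAlgebra.ι ℝ v) =
      TrivSqZeroExt.inl (ExteriorAlgebra.ι ℝ v) + TrivSqZeroExt.inr (ExteriorAlgebra.ι ℝ (f v)) := by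
  rw [exteriorDualHom, ExteriorAlgebra.lift_ι_apply]
  rfl

theorem fst_exteriorDualHom (f : V →ₗ[ℝ] V) (A : ExteriorAlgebra ℝ V) :
    (exteriorDualHom f A).fst = A := by
  have h : (TrivSqZeroExt.fstHom ℝ (ExteriorAlgebra ℝ V) (ExteriorAlgebra ℝ V)).comp
      (exteriorDualHom f) = AlgHom.id ℝ _ := by
    ext v
    simp [exteriorDualHom_ι]
  exact DFunLike.congr_fun h A

/-- The derivation of the exterior algebra which extends the linear map `f`. -/
def exteriorDerivation (f : V →ₗ[ℝ] V) : ExteriorAlgebra ℝ V →ₗ[ℝ] ExteriorAlgebra ℝ V :=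
  (TrivSqZeroExt.sndHom (ExteriorAlgebra ℝ V) (ExteriorAlgebra ℝ V)).restrictScalars ℝ ∘ₗ
    (exteriorDualHom f).toLinearMap

theorem exteriorDerivation_apply (f : V →ₗ[ℝ] V) (A : ExteriorAlgebra ℝ V) :
    exteriorDerivation f A = (exteriorDualHom f A).snd := rfl

theorem exteriorDerivation_one (f : V →ₗ[ℝ] V) : exteriorDerivation f 1 = 0 := by
  simp [exteriorDerivation_apply]

theorem exteriorDerivation_ι_mul (f : V →ₗ[ℝ] V) (v : V) (A : ExteriorAlgebra ℝ V) :
    exteriorDerivation f (ExteriorAlgebra.ι ℝ v * A) =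
      ExteriorAlgebra.ι ℝ (f v) * A + ExteriorAlgebra.ι ℝ v * exteriorDerivation f A := by
  simp only [exteriorDerivation_apply, map_mul, exteriorDualHom_ι]
  simp [fst_exteriorDualHom, add_comm]

/-- Left contraction of an element of the exterior algebra by a linear form. -/
abbrev contract (θ : Module.Dual ℝ V) (A : ExteriorAlgebra ℝ V) : ExteriorAlgebra ℝ V :=
  CliffordAlgebra.contractLeft (Q := (0 : QuadraticForm ℝ V)) θ A

theorem contract_ι_mul (θ : Module.Dual ℝ V) (v : V) (A : ExteriorAlgebra ℝ V) :
    contract θ (ExteriorAlgebra.ι ℝ v * A) = θ v • A - ExteriorAlgebra.ι ℝ v * contract θ A :=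
  CliffordAlgebra.contractLeft_ι_mul (Q := (0 : QuadraticForm ℝ V)) _ _ _

theorem contract_one (θ : Module.Dual ℝ V) : contract θ 1 = 0 :=
  CliffordAlgebra.contractLeft_one (Q := (0 : QuadraticForm ℝ V)) _

theorem exterior_left_induction {P : ExteriorAlgebra ℝ V → Prop} (one : P 1)
    (add : ∀ A B, P A → P B → P (A + B)) (smul : ∀ (r : ℝ) A, P A → P (r • A))
    (ι_mul : ∀ v A, P A → P (ExteriorAlgebra.ι ℝ v * A)) (A : ExteriorAlgebra ℝ V) : P A := by
  refine CliffordAlgebra.left_induction (Q := (0 : QuadraticForm ℝ V)) (P := P) (fun r ↦ ?_) add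
    (fun A v h ↦ ι_mul v A h) A
  rw [Algebra.algebraMap_eq_smul_one]
  exact smul r 1 one

/-- The commutator of a derivation with the antiderivation `contract θ` is again an antiderivation,
hence determined by its values on vectors, where it is `-θ ∘ f`. This correction term cancels half
of the derivative of the metric later on. -/
theorem exteriorDerivation_contract (f : V →ₗ[ℝ] V) (θ : Module.Dual ℝ V)
    (A : ExteriorAlgebra ℝ V) :
    exteriorDerivation f (contract θ A) =
      contract θ (exteriorDerivation f A) - contract (θ ∘ₗ f) A := by
  induction A using exterior_left_induction with
  | one => simp only [contract_one, exteriorDerivation_one, map_zero, contract, sub_zero]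
  | add A B hA hB =>
    simp only [contract, map_add] at hA hB ⊢
    rw [hA, hB]
    abel
  | smul r A hA =>
    simp only [contract, map_smul] at hA ⊢
    rw [hA, smul_sub]
  | ι_mul v A hA =>
    have hadd (B C) : contract θ (B + C) = contract θ B + contract θ C := map_add _ _ _
    simp only [contract_ι_mul, map_sub, map_smul, exteriorDerivation_ι_mul, hA, hadd, mul_sub,
      LinearMap.comp_apply]
    abel

/-- Naturality of contraction, used to move contractions at `x` to the exterior algebra at `p`. -/
theorem map_contract (f : V →ₗ[ℝ] W) (θ : Module.Dual ℝ W) (A : ExteriorAlgebra ℝ V) :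
    ExteriorAlgebra.map f (contract (θ ∘ₗ f) A) = contract θ (ExteriorAlgebra.map f A) := by
  induction A using exterior_left_induction with
  | one => simp only [contract_one, map_zero, map_one]
  | add A B hA hB =>
    simp only [contract, map_add] at hA hB ⊢
    rw [hA, hB]
  | smul r A hA =>
    simp only [contract, map_smul] at hA ⊢
    rw [hA]
  | ι_mul v A hA =>
    simp only [contract_ι_mul, map_sub, map_smul, map_mul, ExteriorAlgebra.map_apply_ι, hA,
      LinearMap.comp_apply]

theorem ιInv_ιMulti_eq_zero {k : ℕ} (hk : k ≠ 1) (v : Fin k → V) :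
    ExteriorAlgebra.ιInv (ExteriorAlgebra.ιMulti ℝ k v) = (0 : V) := by
  -- `ιInv` is the second component of `toTrivSqZeroExt` for this right module structure. In that
  -- extension any product of two vectors is zero, which kills all grades from two on.
  let : Module ℝᵐᵒᵖ V := Module.compHom V ((RingHom.id ℝ).fromOpposite mul_comm)
  have : IsCentralScalar ℝ V := ⟨fun _ _ ↦ rfl⟩
  change (ExteriorAlgebra.toTrivSqZeroExt (ExteriorAlgebra.ιMulti ℝ k v)).snd = 0
  match k, hk with
  | 0, _ => simp
  | k + 2, _ =>
    rw [ExteriorAlgebra.ιMulti_succ_apply, ExteriorAlgebra.ιMulti_succ_apply, ← mul_assoc,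
      map_mul, map_mul]
    simp [Matrix.vecTail]

theorem ιInv_ιMulti_of_eq_one {k : ℕ} (hk : k = 1) (v : Fin k → V) :
    ExteriorAlgebra.ιInv (ExteriorAlgebra.ιMulti ℝ k v) = v ⟨0, hk ▸ one_pos⟩ := by
  subst hk
  rw [ExteriorAlgebra.ιMulti_succ_apply, ExteriorAlgebra.ιMulti_zero_apply, mul_one]
  exact ExteriorAlgebra.ι_leftInverse _

end ExteriorDerivation

set_option linter.unusedSectionVars false

variable {n : ℕ} {M : Type*} [TopologicalSpace M]
  [ChartedSpace (EuclideanSpace ℝ (Fin n)) M] [IsManifold (𝓡 n) ∞ M]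

/-! ### Directional derivatives of vector-valued functions -/

section DirectionalDerivative

variable {p : M} {L L' : Type*} [AddCommGroup L] [Module ℝ L] [AddCommGroup L'] [Module ℝ L']

theorem SmoothScalarNear.mdifferentiableAt {φ : M → ℝ} (hφ : SmoothScalarNear (n := n) p φ) :
    MDifferentiableAt (𝓡 n) 𝓘(ℝ, ℝ) φ p :=
  (Filter.Eventually.self_of_nhds hφ).mdifferentiableAt (by simp)

theorem scalarDeriv_add {a : TangentSpace (𝓡 n) p} {φ ψ : M → ℝ}
    (hφ : MDifferentiableAt (𝓡 n) 𝓘(ℝ, ℝ) φ p) (hψ : MDifferentiableAt (𝓡 n) 𝓘(ℝ, ℝ) ψ p) :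
    scalarDeriv a (fun x ↦ φ x + ψ x) = scalarDeriv a φ + scalarDeriv a ψ := by
  simp [scalarDeriv, mvfderiv_fun_add hφ hψ]

theorem scalarDeriv_mul {a : TangentSpace (𝓡 n) p} {φ ψ : M → ℝ}
    (hφ : MDifferentiableAt (𝓡 n) 𝓘(ℝ, ℝ) φ p) (hψ : MDifferentiableAt (𝓡 n) 𝓘(ℝ, ℝ) ψ p) :
    scalarDeriv a (fun x ↦ φ x * ψ x) = scalarDeriv a φ * ψ p + φ p * scalarDeriv a ψ := by
  simp [scalarDeriv, mvfderiv_fun_mul hφ hψ]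
  ring

theorem scalarDeriv_const (a : TangentSpace (𝓡 n) p) (c : ℝ) :
    scalarDeriv a (fun _ ↦ c) = 0 := by
  simp [scalarDeriv, mvfderiv_const]

theorem scalarDeriv_congr (a : TangentSpace (𝓡 n) p) {φ ψ : M → ℝ} (h : φ =ᶠ[𝓝 p] ψ) :
    scalarDeriv a φ = scalarDeriv a ψ := by
  have h' := h.mfderiv_eq (I := 𝓡 n) (I' := 𝓘(ℝ, ℝ))
  simp only [scalarDeriv, mvfderiv, ContinuousLinearMap.comp_apply]
  rw [h']
  rfl

/-- The function `w` into a vector space has the derivative `w'` in the direction `a`, in the sense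
that this holds for the compositions with linear forms. -/
def HasDirDeriv (a : TangentSpace (𝓡 n) p) (w : M → L) (w' : L) : Prop :=
  ∀ ℓ : Module.Dual ℝ L, MDifferentiableAt (𝓡 n) 𝓘(ℝ, ℝ) (fun x ↦ ℓ (w x)) p ∧
    scalarDeriv a (fun x ↦ ℓ (w x)) = ℓ w'

namespace HasDirDeriv

variable {a : TangentSpace (𝓡 n) p} {w v : M → L} {w' v' : L}

/-- Linear forms separate points. Testing with them spares a topology on the exterior algebra. -/
theorem unique (h : HasDirDeriv a w w') (h' : HasDirDeriv a w v') : w' = v' := by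
  rw [← sub_eq_zero, ← Module.forall_dual_apply_eq_zero_iff ℝ]
  intro ℓ
  rw [map_sub, ← (h ℓ).2, ← (h' ℓ).2, sub_self]

theorem const (c : L) : HasDirDeriv a (fun _ ↦ c) 0 := fun ℓ ↦
  ⟨mdifferentiableAt_const, by rw [scalarDeriv_const, map_zero]⟩

theorem congr (h : HasDirDeriv a w w') (hv : ∀ᶠ x in 𝓝 p, v x = w x) : HasDirDeriv a v w' :=
  fun ℓ ↦ by
    have hℓ : (fun x ↦ ℓ (v x)) =ᶠ[𝓝 p] fun x ↦ ℓ (w x) := by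
      filter_upwards [hv] with x hx using by rw [hx]
    exact ⟨(h ℓ).1.congr_of_eventuallyEq hℓ, (scalarDeriv_congr a hℓ).trans (h ℓ).2⟩

theorem add (h : HasDirDeriv a w w') (h' : HasDirDeriv a v v') :
    HasDirDeriv a (fun x ↦ w x + v x) (w' + v') := fun ℓ ↦ by
  simp only [map_add]
  exact ⟨(h ℓ).1.add (h' ℓ).1, by
    rw [scalarDeriv_add (h ℓ).1 (h' ℓ).1, (h ℓ).2, (h' ℓ).2]⟩

theorem sum {ι : Type*} (s : Finset ι) {w : ι → M → L} {w' : ι → L}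
    (h : ∀ i ∈ s, HasDirDeriv a (w i) (w' i)) :
    HasDirDeriv a (fun x ↦ ∑ i ∈ s, w i x) (∑ i ∈ s, w' i) := by
  classical
  induction s using Finset.induction_on with
  | empty => simpa using HasDirDeriv.const 0
  | insert i s hi ih =>
    simp only [Finset.sum_insert hi]
    exact (h i (by simp)).add (ih fun j hj ↦ h j (by simp [hj]))

theorem smul {φ : M → ℝ} (hφ : MDifferentiableAt (𝓡 n) 𝓘(ℝ, ℝ) φ p) (h : HasDirDeriv a w w') :
    HasDirDeriv a (fun x ↦ φ x • w x) (scalarDeriv a φ • w p + φ p • w') := fun ℓ ↦ by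
  simp only [map_smul, map_add, smul_eq_mul]
  exact ⟨hφ.mul (h ℓ).1, by rw [scalarDeriv_mul hφ (h ℓ).1, (h ℓ).2]⟩

theorem map (f : L →ₗ[ℝ] L') (h : HasDirDeriv a w w') : HasDirDeriv a (fun x ↦ f (w x)) (f w') :=
  fun ℓ ↦ h (ℓ ∘ₗ f)

end HasDirDeriv

end DirectionalDerivative

/-! ### Coordinate expressions of multivector fields -/

section FrameTransport

/-- The domain on which the coordinate vector fields of the preferred chart at `p` are a frame. -/
abbrev frameDomain (p : M) : Set M :=
  (trivializationAt (EuclideanSpace ℝ (Fin n)) (TangentSpace (𝓡 n) : M → Type _) p).baseSet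

theorem mem_frameDomain_self (p : M) : p ∈ frameDomain (n := n) p :=
  FiberBundle.mem_baseSet_trivializationAt' p

theorem frameDomain_mem_nhds (p : M) : frameDomain (n := n) p ∈ 𝓝 p :=
  (Bundle.Trivialization.open_baseSet _).mem_nhds (mem_frameDomain_self p)

/-- The basis of the tangent space at `x` which consists of the coordinate vectors of the preferred
chart at `p`. -/
def coordBasis {p x : M} (hx : x ∈ frameDomain (n := n) p) :
    Module.Basis (Fin n) ℝ (TangentSpace (𝓡 n) x) :=
  (trivializationAt (EuclideanSpace ℝ (Fin n)) (TangentSpace (𝓡 n) : M → Type _) p).basisAt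
    (EuclideanSpace.basisFun (Fin n) ℝ).toBasis hx

theorem coordBasis_apply {p x : M} (hx : x ∈ frameDomain (n := n) p) (i : Fin n) :
    coordBasis hx i = coordFrame p i x :=
  (Bundle.Trivialization.localFrame_apply_of_mem_baseSet _ _ hx).symm

/-- The map from the tangent space at `x` to the tangent space at `p` which matches the coordinate
vectors of the preferred chart at `p`. -/
def frameTransport (p x : M) : TangentSpace (𝓡 n) x →ₗ[ℝ] TangentSpace (𝓡 n) p :=
  ((trivializationAt (EuclideanSpace ℝ (Fin n)) (TangentSpace (𝓡 n) : M → Type _)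
      p).linearEquivAt ℝ p (mem_frameDomain_self p)).symm.toLinearMap ∘ₗ
    (trivializationAt (EuclideanSpace ℝ (Fin n)) (TangentSpace (𝓡 n) : M → Type _)
      p).linearMapAt ℝ x

theorem frameTransport_coordFrame {p x : M} (hx : x ∈ frameDomain (n := n) p) (i : Fin n) :
    frameTransport p x (coordFrame p i x) = coordFrame p i p := by
  let e := trivializationAt (EuclideanSpace ℝ (Fin n)) (TangentSpace (𝓡 n) : M → Type _) p
  rw [← coordBasis_apply hx, ← coordBasis_apply (mem_frameDomain_self p)]
  simp only [coordBasis, Bundle.Trivialization.basisAt, Module.Basis.map_apply, frameTransport,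
    LinearMap.comp_apply]
  rw [Bundle.Trivialization.linearMapAt_def_of_mem _ hx]
  exact congrArg (e.linearEquivAt ℝ p (mem_frameDomain_self p)).symm
    ((e.linearEquivAt ℝ x hx).apply_symm_apply _)

theorem frameTransport_self (p : M) : frameTransport (n := n) p p = LinearMap.id := by
  refine (coordBasis (mem_frameDomain_self p)).ext fun i ↦ ?_
  rw [coordBasis_apply, frameTransport_coordFrame (mem_frameDomain_self p), LinearMap.id_apply]

variable (g : PseudoRiemannianMetric n M)

/-- The coordinate expression of a multivector field near `p` in terms of wedge products of
coordinate vector fields, as a function into the exterior algebra of the tangent space at `p`. -/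
def expression (p : M) (A : (x : M) → g.Multivector x) (x : M) :
    ExteriorAlgebra ℝ (TangentSpace (𝓡 n) p) :=
  ExteriorAlgebra.map (frameTransport p x) (g.toExterior x (A x))

variable {g} {p : M} {A : (x : M) → g.Multivector x}

theorem expression_self : expression g p A p = g.toExterior p (A p) := by
  rw [expression, frameTransport_self, ExteriorAlgebra.map_id, AlgHom.id_apply]

theorem expression_coordBlade (J : Finset (Fin n)) {x : M} (hx : x ∈ frameDomain (n := n) p) :
    expression g p (coordBlade g p J) x =
      ExteriorAlgebra.ιMulti ℝ J.card fun k ↦ coordFrame p (J.orderEmbOfFin rfl k) p := by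
  rw [expression, coordBlade, LinearEquiv.apply_symm_apply, ExteriorAlgebra.map_apply_ιMulti]
  congr 1
  ext1 k
  exact frameTransport_coordFrame hx _

/-- Coordinate blades have constant expression near `p`, so only the smooth coefficients are
differentiated. -/
theorem SmoothMultivectorNear.exists_hasDirDeriv (hA : SmoothMultivectorNear g p A)
    (a : TangentSpace (𝓡 n) p) : ∃ w, HasDirDeriv a (expression g p A) w := by
  obtain ⟨f, hf, hA⟩ := hA
  refine ⟨_, (HasDirDeriv.sum Finset.univ fun J _ ↦ (HasDirDeriv.const (a := a)
    (ExteriorAlgebra.ιMulti ℝ J.card fun k ↦ coordFrame p (J.orderEmbOfFin rfl k) p)).smul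
      (hf J).mdifferentiableAt).congr ?_⟩
  filter_upwards [hA, frameDomain_mem_nhds (n := n) p] with x hx hxp
  simp only [← expression_coordBlade (g := g) _ hxp, expression, hx, map_sum, map_smul]

theorem toExterior_contractLeft (x : M) (θ : Module.Dual ℝ (TangentSpace (𝓡 n) x))
    (B : g.Multivector x) :
    g.toExterior x (CliffordAlgebra.contractLeft θ B) = contract θ (g.toExterior x B) :=
  CliffordAlgebra.changeForm_contractLeft CliffordAlgebra.changeForm.associated_neg_proof θ B

theorem toExterior_one (x : M) : g.toExterior x 1 = 1 :=
  CliffordAlgebra.changeForm_one CliffordAlgebra.changeForm.associated_neg_proof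

theorem toExterior_ofVector_mul' (x : M) (a : TangentSpace (𝓡 n) x) (B : g.Multivector x) :
    g.toExterior x (g.ofVector x a * B) =
      ExteriorAlgebra.ι ℝ a * g.toExterior x B + contract (g.bilin x a) (g.toExterior x B) := by
  rw [toExterior_ofVector_mul, map_add, LinearEquiv.apply_symm_apply, toExterior_contractLeft]

/-- Seen from the tangent space at `p`, all dependence of the form `e_i·` on `x` sits in the metric
coefficients; the coordinate forms stay fixed. -/
theorem bilin_eq_sum_comp_frameTransport {x : M} (hx : x ∈ frameDomain (n := n) p) (i : Fin n) :
    g.bilin x (coordFrame p i x) =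
      (∑ j, g.dot x (coordFrame p i x) (coordFrame p j x) •
        (coordBasis (mem_frameDomain_self p)).coord j) ∘ₗ frameTransport p x := by
  refine (coordBasis hx).ext fun k ↦ ?_
  rw [LinearMap.comp_apply, coordBasis_apply, frameTransport_coordFrame hx,
    ← coordBasis_apply (mem_frameDomain_self p)]
  simp [Module.Basis.coord_apply, Finsupp.single_apply, PseudoRiemannianMetric.bilin]

theorem expression_coordFrame_mul {x : M} (hx : x ∈ frameDomain (n := n) p) (i : Fin n) :
    expression g p (fun y ↦ g.ofVector y (coordFrame p i y) * A y) x =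
      ExteriorAlgebra.ι ℝ (coordFrame p i p) * expression g p A x +
        ∑ j, g.dot x (coordFrame p i x) (coordFrame p j x) •
          contract ((coordBasis (mem_frameDomain_self p)).coord j) (expression g p A x) := by
  rw [expression, toExterior_ofVector_mul', map_add, map_mul, ExteriorAlgebra.map_apply_ι,
    frameTransport_coordFrame hx, bilin_eq_sum_comp_frameTransport hx, map_contract]
  simp only [expression, contract, map_sum, map_smul, LinearMap.sum_apply, LinearMap.smul_apply]

theorem HasDirDeriv.coordFrame_mul {a : TangentSpace (𝓡 n) p}
    {w : ExteriorAlgebra ℝ (TangentSpace (𝓡 n) p)} (h : HasDirDeriv a (expression g p A) w)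
    (i : Fin n) :
    HasDirDeriv a (expression g p fun y ↦ g.ofVector y (coordFrame p i y) * A y)
      (ExteriorAlgebra.ι ℝ (coordFrame p i p) * w + contract (g.bilin p (coordFrame p i p)) w +
        contract (∑ j, scalarDeriv a (fun x ↦ g.dot x (coordFrame p i x) (coordFrame p j x)) •
          (coordBasis (mem_frameDomain_self p)).coord j) (g.toExterior p (A p))) := by
  have hd (j : Fin n) := (SmoothVectorNear.dot g (.coordFrame i)
    (.coordFrame (p := p) j)).mdifferentiableAt
  have hθ : g.bilin p (coordFrame p i p) = ∑ j, g.dot p (coordFrame p i p) (coordFrame p j p) •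
      (coordBasis (mem_frameDomain_self p)).coord j := by
    rw [bilin_eq_sum_comp_frameTransport (mem_frameDomain_self p), frameTransport_self,
      LinearMap.comp_id]
  have h' := ((h.map (LinearMap.mulLeft ℝ (ExteriorAlgebra.ι ℝ (coordFrame p i p)))).add
    (HasDirDeriv.sum Finset.univ fun j _ ↦ (h.map (CliffordAlgebra.contractLeft
      (Q := (0 : QuadraticForm ℝ (TangentSpace (𝓡 n) p)))
      ((coordBasis (mem_frameDomain_self p)).coord j))).smul (hd j))).congr
    (v := expression g p fun y ↦ g.ofVector y (coordFrame p i y) * A y) (by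
      filter_upwards [frameDomain_mem_nhds (n := n) p] with x hx
      exact expression_coordFrame_mul hx i)
  convert! h' using 1
  -- At `p` the undifferentiated coefficients reassemble the form `e_i·`.
  rw [hθ, ← expression_self, add_assoc]
  simp only [contract, map_sum, map_smul, LinearMap.sum_apply, LinearMap.smul_apply,
    Finset.sum_add_distrib, LinearMap.mulLeft_apply]
  congr 1
  exact add_comm _ _

end FrameTransport

/-! ### Locality and closure properties of smooth fields -/

section SmoothFields

variable {g : PseudoRiemannianMetric n M} {p : M}

theorem SmoothScalarNear.eventually {φ : M → ℝ} (hφ : SmoothScalarNear (n := n) p φ) :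
    ∀ᶠ x in 𝓝 p, SmoothScalarNear (n := n) x φ :=
  eventually_eventually_nhds.2 hφ

theorem SmoothScalarNear.congr {φ ψ : M → ℝ} (hφ : SmoothScalarNear (n := n) p φ)
    (h : ∀ᶠ x in 𝓝 p, ψ x = φ x) : SmoothScalarNear (n := n) p ψ := by
  filter_upwards [hφ, eventually_eventually_nhds.2 h] with x hx h' using
    hx.congr_of_eventuallyEq h'

theorem SmoothVectorNear.eventually {u : (x : M) → TangentSpace (𝓡 n) x}
    (hu : SmoothVectorNear p u) : ∀ᶠ x in 𝓝 p, SmoothVectorNear x u :=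
  eventually_eventually_nhds.2 hu

theorem SmoothVectorNear.congr {u v : (x : M) → TangentSpace (𝓡 n) x}
    (hu : SmoothVectorNear p u) (h : ∀ᶠ x in 𝓝 p, v x = u x) : SmoothVectorNear p v := by
  filter_upwards [hu, eventually_eventually_nhds.2 h] with x hx h'
  exact hx.congr_of_eventuallyEq (by filter_upwards [h'] with y hy using by rw [hy])

theorem SmoothVectorNear.sum {ι : Type*} (s : Finset ι)
    {u : ι → (x : M) → TangentSpace (𝓡 n) x} (hu : ∀ i ∈ s, SmoothVectorNear p (u i)) :
    SmoothVectorNear p (fun x ↦ ∑ i ∈ s, u i x) :=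
  ((smoothVectorFields p).sum_mem hu).congr (.of_forall fun x ↦ by simp)

theorem SmoothVectorNear.exists_coeff {u : (x : M) → TangentSpace (𝓡 n) x}
    (hu : SmoothVectorNear p u) :
    ∃ f : Fin n → M → ℝ, (∀ i, SmoothScalarNear (n := n) p (f i)) ∧
      ∀ᶠ x in 𝓝 p, u x = ∑ i, f i x • GeometricCalculus.coordFrame p i x := by
  let e := trivializationAt (EuclideanSpace ℝ (Fin n)) (TangentSpace (𝓡 n) : M → Type _) p
  let b := (EuclideanSpace.basisFun (Fin n) ℝ).toBasis
  refine ⟨fun i x ↦ e.localFrameCoeff (𝓡 n) b i x (u x), fun i ↦ ?_, ?_⟩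
  · filter_upwards [frameDomain_mem_nhds (n := n) p, hu] with x hx hux
    exact contMDiffAt_localFrameCoeff b hx hux i
  · exact e.eventually_eq_localFrame_sum_coeff_smul (I := 𝓡 n) b (mem_frameDomain_self p)

/-- Smoothness near `x` refers to the frame of the chart at `x`, not at `p`. Induction over the
generators reduces this change of frame to vector fields, whose smoothness is independent of the
chart. -/
theorem SmoothMultivectorNear.eventually {A : (x : M) → g.Multivector x}
    (hA : SmoothMultivectorNear g p A) : ∀ᶠ x in 𝓝 p, SmoothMultivectorNear g x A := by
  induction hA.generated with
  | one => exact .of_forall fun x ↦ Generated.one.smooth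
  | mul i hB ih =>
    filter_upwards [ih hB.smooth, (SmoothVectorNear.coordFrame i).eventually] with x hx hi
      using hi.toMultivector.mul hx
  | add hB hC ih ih' =>
    filter_upwards [ih hB.smooth, ih' hC.smooth] with x hx hx' using hx.add hx'
  | smul hφ hB ih =>
    filter_upwards [ih hB.smooth, hφ.eventually] with x hx hφx using hx.smul hφx
  | congr hB h ih =>
    filter_upwards [ih hB.smooth, eventually_eventually_nhds.2 h] with x hx h' using hx.congr h'

theorem vectorPart_sum_smul {x : M} {ι : Type*} (s : Finset ι) (c : ι → ℝ)
    (A : ι → g.Multivector x) :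
    g.vectorPart x (∑ i ∈ s, c i • A i) = ∑ i ∈ s, c i • g.vectorPart x (A i) := by
  simp only [PseudoRiemannianMetric.vectorPart, map_sum, map_smul]

/-- The grade one projection kills every coordinate blade except the coordinate vectors themselves.
-/
theorem SmoothMultivectorNear.vectorPart {A : (x : M) → g.Multivector x}
    (hA : SmoothMultivectorNear g p A) : SmoothVectorNear p (fun x ↦ g.vectorPart x (A x)) := by
  obtain ⟨f, hf, hA⟩ := hA
  have hJ (J : Finset (Fin n)) : SmoothVectorNear p
      (fun x ↦ g.vectorPart x (GeometricCalculus.coordBlade g p J x)) := by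
    simp only [PseudoRiemannianMetric.vectorPart, GeometricCalculus.coordBlade,
      LinearEquiv.apply_symm_apply]
    by_cases h : J.card = 1
    · simp only [ιInv_ιMulti_of_eq_one h]
      exact .coordFrame _
    · simp only [ιInv_ιMulti_eq_zero h]
      exact .zero
  refine (SmoothVectorNear.sum Finset.univ fun J _ ↦ (hJ J).smul (hf J)).congr ?_
  filter_upwards [hA] with x hx
  rw [hx, vectorPart_sum_smul]

theorem SmoothScalarNear.scalarDeriv {φ : M → ℝ} {a : (x : M) → TangentSpace (𝓡 n) x}
    (hφ : SmoothScalarNear (n := n) p φ) (ha : SmoothVectorNear p a) :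
    SmoothScalarNear (n := n) p (fun x ↦ scalarDeriv (a x) φ) := by
  obtain ⟨U, hU, hUo, hpU⟩ := eventually_nhds_iff.1 (hφ.and ha)
  filter_upwards [hUo.mem_nhds hpU] with x hx
  have h := ContMDiffOn.contMDiffOn_tangentMapWithin (m := ∞)
    (fun y hy ↦ (hU y hy).1.contMDiffWithinAt) (by simp) hUo.uniqueMDiffOn
  have h' := (h ⟨x, a x⟩ hx).contMDiffAt
    ((hUo.preimage (FiberBundle.continuous_proj _ _)).mem_nhds hx)
  -- The derivative of `φ` along `a` is the fibre component of the tangent map of `φ` composed with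
  -- the section `a`.
  have h'' := (contMDiff_snd_tangentBundle_modelSpace (n := ∞) ℝ 𝓘(ℝ, ℝ)).contMDiffAt.comp x
    (h'.comp x (hU x hx).2)
  refine h''.congr_of_eventuallyEq ?_
  filter_upwards [hUo.mem_nhds hx] with y hy
  change mfderiv (𝓡 n) 𝓘(ℝ, ℝ) φ y (a y) = mfderivWithin (𝓡 n) 𝓘(ℝ, ℝ) φ U y (a y)
  rw [mfderivWithin_of_isOpen hUo hy]

end SmoothFields

/-! ### Locality and coordinate formula for connections -/

section Connections

variable {p : M}

/-- The coordinate vector fields of the preferred chart at `p` as smooth vector fields near `p`. -/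
def coordField (p : M) (i : Fin n) : smoothVectorFields (n := n) p :=
  ⟨coordFrame p i, .coordFrame i⟩

/-- The indicator of the coincidence set serves as cut-off: since fields need to be smooth only near
`p`, no bump function is required. The product rule then yields locality. -/
theorem exists_scalar_eventually_one {X : M → Type*} [∀ x, AddCommGroup (X x)]
    [∀ x, Module ℝ (X x)] {u v : (x : M) → X x} (h : ∀ᶠ x in 𝓝 p, u x = v x) :
    ∃ φ : M → ℝ, (∀ᶠ x in 𝓝 p, φ x = 1) ∧ ∀ x, φ x • u x = φ x • v x := by
  classical
  refine ⟨fun x ↦ if u x = v x then 1 else 0, ?_, fun x ↦ ?_⟩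
  · filter_upwards [h] with x hx using if_pos hx
  · by_cases hx : u x = v x <;> simp [hx]

theorem scalarDeriv_eq_zero {a : TangentSpace (𝓡 n) p} {φ : M → ℝ} {c : ℝ}
    (h : ∀ᶠ x in 𝓝 p, φ x = c) : scalarDeriv a φ = 0 :=
  (scalarDeriv_congr a h).trans (scalarDeriv_const a c)

namespace IsAffineConnection

variable {D : VectorOperator n M}

theorem congr (hD : IsAffineConnection D) (a : TangentSpace (𝓡 n) p)
    {u v : smoothVectorFields (n := n) p} (h : ∀ᶠ x in 𝓝 p, u.1 x = v.1 x) :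
    D p a u = D p a v := by
  obtain ⟨φ, hφ, huv⟩ := exists_scalar_eventually_one h
  have hs : SmoothScalarNear (n := n) p φ := (SmoothScalarNear.const 1).congr hφ
  have h' : scalarMul φ hs u = scalarMul φ hs v := Subtype.ext (funext huv)
  simpa [hD.scalar_mul, scalarDeriv_eq_zero hφ, hφ.self_of_nhds] using congrArg (D p a) h'

theorem eq_sum (hD : IsAffineConnection D) (a : TangentSpace (𝓡 n) p)
    {u : smoothVectorFields (n := n) p} {f : Fin n → M → ℝ}
    (hf : ∀ i, SmoothScalarNear (n := n) p (f i))
    (hu : ∀ᶠ x in 𝓝 p, u.1 x = ∑ i, f i x • coordFrame p i x) :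
    D p a u =
      ∑ i, (scalarDeriv a (f i) • coordFrame p i p + f i p • D p a (coordField p i)) := by
  have h : D p a u = D p a (∑ i, scalarMul (f i) (hf i) (coordField p i)) := by
    refine hD.congr a ?_
    filter_upwards [hu] with x hx
    rw [hx]
    simp [scalarMul, coordField]
  rw [h]
  refine (map_sum (AddMonoidHom.mk' (D p a) (hD.add p a)) _ _).trans
    (Finset.sum_congr rfl fun i _ ↦ ?_)
  exact hD.scalar_mul p a (f i) (hf i) (coordField p i)

end IsAffineConnection

end Connections

/-! ### Properties of multivector directional derivatives -/

section MDD

variable {g : PseudoRiemannianMetric n M} {p : M}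

theorem algebraMap_injective (x : M) : Function.Injective (algebraMap ℝ (g.Multivector x)) := by
  intro r s h
  have h' := congrArg (g.toExterior x) h
  have hmap (r : ℝ) : g.toExterior x (algebraMap ℝ _ r) = algebraMap ℝ _ r :=
    CliffordAlgebra.changeForm_algebraMap CliffordAlgebra.changeForm.associated_neg_proof r
  rw [hmap, hmap] at h'
  exact (ExteriorAlgebra.algebraMap_leftInverse _).injective h'

theorem ofVector_injective (x : M) : Function.Injective (g.ofVector x) :=
  (show Function.LeftInverse (g.vectorPart x) (g.ofVector x) from
    g.vectorPart_ofVector x).injective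

theorem ofVector_mul_add_swap (x : M) (a b : TangentSpace (𝓡 n) x) :
    g.ofVector x a * g.ofVector x b + g.ofVector x b * g.ofVector x a =
      algebraMap ℝ (g.Multivector x) (2 * g.dot x a b) := by
  rw [CliffordAlgebra.ι_mul_ι_add_swap]
  congr 1
  simp [QuadraticMap.polar, PseudoRiemannianMetric.quadraticForm, PseudoRiemannianMetric.bilin,
    g.symm x b a]
  ring

theorem MultivectorOperator.IsSmooth.restrictToVectors
    {D : MultivectorOperator g} (hs : MultivectorOperator.IsSmooth D) :
    VectorOperator.IsSmooth (GeometricCalculus.restrictToVectors g D) := by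
  intro p a u
  obtain ⟨B, hB⟩ := hs p a (vectorField g u)
  refine ⟨⟨fun x ↦ g.vectorPart x (B.1 x), SmoothMultivectorNear.vectorPart B.2⟩, ?_⟩
  filter_upwards [hB, SmoothVectorNear.eventually u.2] with x ⟨_, hx⟩ hux
  exact ⟨hux, congrArg (g.vectorPart x) hx⟩

namespace IsMDD

variable {D : MultivectorOperator g}

theorem smul (hD : IsMDD g D) (a : TangentSpace (𝓡 n) p) {φ : M → ℝ}
    (hφ : SmoothScalarNear (n := n) p φ) {A : (x : M) → g.Multivector x}
    (hA : SmoothMultivectorNear g p A) :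
    D p a ⟨fun x ↦ φ x • A x, hA.smul hφ⟩ = scalarDeriv a φ • A p + φ p • D p a ⟨A, hA⟩ := by
  have h : (⟨fun x ↦ φ x • A x, hA.smul hφ⟩ : smoothMultivectorFields g p) =
      scalarField g φ hφ * ⟨A, hA⟩ :=
    Subtype.ext (funext fun x ↦ Algebra.smul_def _ _)
  rw [h, hD.mul, hD.scalar, Algebra.smul_def, Algebra.smul_def]
  rfl

theorem congr (hD : IsMDD g D) (a : TangentSpace (𝓡 n) p) {A B : (x : M) → g.Multivector x}
    (hA : SmoothMultivectorNear g p A) (hB : SmoothMultivectorNear g p B)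
    (h : ∀ᶠ x in 𝓝 p, A x = B x) : D p a ⟨A, hA⟩ = D p a ⟨B, hB⟩ := by
  obtain ⟨φ, hφ, hAB⟩ := exists_scalar_eventually_one h
  have hs : SmoothScalarNear (n := n) p φ := (SmoothScalarNear.const 1).congr hφ
  have h' : (⟨fun x ↦ φ x • A x, hA.smul hs⟩ : smoothMultivectorFields g p) =
    ⟨fun x ↦ φ x • B x, hB.smul hs⟩ := Subtype.ext (funext hAB)
  have h'' := congrArg (D p a) h'
  rw [hD.smul a hs hA, hD.smul a hs hB, scalarDeriv_eq_zero hφ, hφ.self_of_nhds] at h''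
  simpa using h''

theorem one (hD : IsMDD g D) (a : TangentSpace (𝓡 n) p)
    (h : SmoothMultivectorNear g p (fun _ ↦ 1)) : D p a ⟨fun _ ↦ 1, h⟩ = 0 := by
  have h' := hD.scalar p a (fun _ ↦ 1) (.const 1)
  rw [scalarDeriv_const, map_zero] at h'
  rw [← h']
  exact congrArg _ (Subtype.ext (funext fun x ↦ (map_one _).symm))

theorem ofVector_restrict (hD : IsMDD g D) (a : TangentSpace (𝓡 n) p)
    (u : smoothVectorFields (n := n) p) :
    g.ofVector p (restrictToVectors g D p a u) = D p a (vectorField g u) :=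
  hD.vector p a u

theorem vector_mul (hD : IsMDD g D) (a : TangentSpace (𝓡 n) p)
    (u : smoothVectorFields (n := n) p) {A : (x : M) → g.Multivector x}
    (hA : SmoothMultivectorNear g p A)
    (h : SmoothMultivectorNear g p (fun x ↦ g.ofVector x (u.1 x) * A x)) :
    D p a ⟨fun x ↦ g.ofVector x (u.1 x) * A x, h⟩ =
      g.ofVector p (restrictToVectors g D p a u) * A p + g.ofVector p (u.1 p) * D p a ⟨A, hA⟩ := by
  rw [hD.ofVector_restrict]
  exact hD.mul p a (vectorField g u) ⟨A, hA⟩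

theorem isAffineConnection (hD : IsMDD g D) : IsAffineConnection (restrictToVectors g D) where
  linear_direction p a b α β u := by
    apply ofVector_injective (g := g)
    simp only [map_add, map_smul, hD.ofVector_restrict, hD.linear_direction]
  add p a u v := by
    apply ofVector_injective (g := g)
    simp only [map_add, hD.ofVector_restrict, ← hD.add]
    exact congrArg _ (Subtype.ext (funext fun x ↦ map_add _ _ _))
  scalar_mul p a φ hφ u := by
    apply ofVector_injective (g := g)
    simp only [map_add, map_smul, hD.ofVector_restrict]
    refine Eq.trans ?_ (hD.smul a hφ (vectorField g u).2)
    exact congrArg _ (Subtype.ext (funext fun x ↦ map_smul _ _ _))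

/-- Differentiate the Clifford relation `ab + ba = 2 a·b`. The four product-rule terms pair up into
two further instances of that relation, and scalars embed injectively. -/
theorem isMetricCompatible (hD : IsMDD g D) :
    IsMetricCompatible g (restrictToVectors g D) := by
  intro p c a b
  have hs := SmoothVectorNear.dot g a.2 b.2
  have h : vectorField g a * vectorField g b + vectorField g b * vectorField g a =
      scalarField g (fun x ↦ 2 * g.dot x (a.1 x) (b.1 x)) ((SmoothScalarNear.const 2).mul hs) :=
    Subtype.ext (funext fun x ↦ ofVector_mul_add_swap x _ _)
  have h' := congrArg (D p c) h
  rw [hD.add, hD.mul, hD.mul, hD.scalar, ← hD.ofVector_restrict, ← hD.ofVector_restrict,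
    scalarDeriv_mul mdifferentiableAt_const hs.mdifferentiableAt, scalarDeriv_const] at h'
  have h₁ := ofVector_mul_add_swap (g := g) p (restrictToVectors g D p c a) (b.1 p)
  have h₂ := ofVector_mul_add_swap (g := g) p (a.1 p) (restrictToVectors g D p c b)
  have h₃ : algebraMap ℝ (g.Multivector p)
      (2 * (g.dot p (restrictToVectors g D p c a) (b.1 p) +
        g.dot p (a.1 p) (restrictToVectors g D p c b))) =
      algebraMap ℝ (g.Multivector p)
        (2 * scalarDeriv c fun x ↦ g.dot x (a.1 x) (b.1 x)) := by
    rw [mul_add, map_add, ← h₁, ← h₂]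
    rw [zero_mul, zero_add] at h'
    rw [← h']
    simp only [vectorField]
    abel
  exact mul_left_cancel₀ two_ne_zero (algebraMap_injective p h₃)

/-- Both operators obey the same rule at each step by which smooth fields are generated, and the
only data entering are the derivatives of coordinate fields. -/
theorem eq_of_restrict_eq {D' : MultivectorOperator g} (hD : IsMDD g D) (hD' : IsMDD g D')
    (h : restrictToVectors g D = restrictToVectors g D') : D = D' := by
  funext p a ⟨A, hA⟩
  change SmoothMultivectorNear g p A at hA
  induction hA.generated with
  | one => exact (hD.one a _).trans (hD'.one a _).symm
  | mul i hB ih =>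
    refine (hD.vector_mul a (coordField p i) hB.smooth hA).trans ?_
    rw [ih hB.smooth, h]
    exact (hD'.vector_mul a (coordField p i) hB.smooth hA).symm
  | add hB hC ih ih' =>
    exact (hD.add p a ⟨_, hB.smooth⟩ ⟨_, hC.smooth⟩).trans ((congrArg₂ (· + ·) (ih hB.smooth)
      (ih' hC.smooth)).trans (hD'.add p a ⟨_, hB.smooth⟩ ⟨_, hC.smooth⟩).symm)
  | smul hφ hB ih => rw [hD.smul a hφ hB.smooth, hD'.smul a hφ hB.smooth, ih hB.smooth]
  | congr hB hBC ih =>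
    rw [hD.congr a hA hB.smooth hBC, hD'.congr a hA hB.smooth hBC, ih hB.smooth]

/-- Along the generation of `A`, each rule expresses the derivative through fields already known to
be smooth. -/
theorem isSmooth_of_restrict (hD : IsMDD g D)
    (hs : VectorOperator.IsSmooth (restrictToVectors g D)) : MultivectorOperator.IsSmooth D := by
  rintro p a ⟨A, hA⟩
  change SmoothMultivectorNear g p A at hA
  induction hA.generated with
  | one =>
    refine ⟨⟨_, SmoothMultivectorNear.zero⟩, .of_forall fun x ↦ ?_⟩
    exact ⟨Generated.one.smooth, hD.one _ _⟩
  | mul i hB ih =>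
    obtain ⟨B', hB'⟩ := ih hB.smooth
    obtain ⟨v, hv⟩ := hs p a (coordField p i)
    refine ⟨⟨_, ((SmoothVectorNear.toMultivector v.2).mul hB.smooth).add
      ((SmoothVectorNear.coordFrame i).toMultivector.mul B'.2)⟩, ?_⟩
    filter_upwards [hB', hv, hA.eventually] with x ⟨hx, hx'⟩ ⟨hi, hi'⟩ hAx
    exact ⟨hAx, (hD.vector_mul (a.1 x) ⟨_, hi⟩ hx hAx).trans (by rw [hi', hx']; rfl)⟩
  | add hB hC ih ih' =>
    obtain ⟨B', hB'⟩ := ih hB.smooth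
    obtain ⟨C', hC'⟩ := ih' hC.smooth
    refine ⟨B' + C', ?_⟩
    filter_upwards [hB', hC'] with x ⟨hx, hx'⟩ ⟨hy, hy'⟩
    exact ⟨SmoothMultivectorNear.add hx hy,
      (hD.add x (a.1 x) ⟨_, hx⟩ ⟨_, hy⟩).trans (by rw [hx', hy']; rfl)⟩
  | smul hφ hB ih =>
    obtain ⟨B', hB'⟩ := ih hB.smooth
    refine ⟨⟨_, (hB.smooth.smul (hφ.scalarDeriv a.2)).add (SmoothMultivectorNear.smul hφ B'.2)⟩,
      ?_⟩
    filter_upwards [hB', hφ.eventually] with x ⟨hx, hx'⟩ hφx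
    exact ⟨SmoothMultivectorNear.smul hφx hx, (hD.smul (a.1 x) hφx hx).trans (by rw [hx'])⟩
  | congr hB h ih =>
    obtain ⟨B', hB'⟩ := ih hB.smooth
    refine ⟨B', ?_⟩
    filter_upwards [hB', hA.eventually, eventually_eventually_nhds.2 h] with x ⟨hx, hx'⟩ hAx hh
    exact ⟨hAx, (hD.congr (a.1 x) hAx hx hh).trans hx'⟩

end IsMDD

end MDD

/-! ### Extension of a metric-compatible connection to multivectors -/

section FrameDerivation

variable {g : PseudoRiemannianMetric n M} {p : M}

/-- The operator `d` satisfies the rules which determine the derivative at `p` in the direction `a`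
of smooth multivector fields from the derivatives `c i` of the coordinate vector fields. -/
structure IsFrameDerivation (a : TangentSpace (𝓡 n) p) (c : Fin n → TangentSpace (𝓡 n) p)
    (d : ((x : M) → g.Multivector x) → g.Multivector p) : Prop where
  one : d (fun _ ↦ 1) = 0
  coordFrame_mul (i : Fin n) {A : (x : M) → g.Multivector x} : SmoothMultivectorNear g p A →
    d (fun x ↦ g.ofVector x (coordFrame p i x) * A x) =
      g.ofVector p (c i) * A p + g.ofVector p (coordFrame p i p) * d A
  add {A B : (x : M) → g.Multivector x} : SmoothMultivectorNear g p A →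
    SmoothMultivectorNear g p B → d (fun x ↦ A x + B x) = d A + d B
  smul {φ : M → ℝ} {A : (x : M) → g.Multivector x} : SmoothScalarNear (n := n) p φ →
    SmoothMultivectorNear g p A → d (fun x ↦ φ x • A x) = scalarDeriv a φ • A p + φ p • d A
  congr {A B : (x : M) → g.Multivector x} : SmoothMultivectorNear g p A →
    (∀ᶠ x in 𝓝 p, B x = A x) → d B = d A

open Classical in
/-- The derivative at `p` in the direction `a` of a multivector field, for which the coordinate
vectors have the derivatives prescribed by the linear map `Γ`. -/
def frameDerivation (g : PseudoRiemannianMetric n M) (a : TangentSpace (𝓡 n) p)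
    (Γ : TangentSpace (𝓡 n) p →ₗ[ℝ] TangentSpace (𝓡 n) p) (A : (x : M) → g.Multivector x) :
    g.Multivector p :=
  if h : ∃ w, HasDirDeriv a (expression g p A) w then
    (g.toExterior p).symm (h.choose + exteriorDerivation Γ (g.toExterior p (A p)))
  -- Never reached for smooth fields, by `SmoothMultivectorNear.exists_hasDirDeriv`.
  else 0

theorem HasDirDeriv.frameDerivation_eq {a : TangentSpace (𝓡 n) p}
    {A : (x : M) → g.Multivector x} {w : ExteriorAlgebra ℝ (TangentSpace (𝓡 n) p)}
    (h : HasDirDeriv a (expression g p A) w)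
    (Γ : TangentSpace (𝓡 n) p →ₗ[ℝ] TangentSpace (𝓡 n) p) :
    g.toExterior p (frameDerivation g a Γ A) =
      w + exteriorDerivation Γ (g.toExterior p (A p)) := by
  have h' : ∃ w, HasDirDeriv a (expression g p A) w := ⟨w, h⟩
  rw [frameDerivation, dif_pos h', LinearEquiv.apply_symm_apply, h'.choose_spec.unique h]

/-- The core computation. Only `coordFrame_mul` needs the metric: its contraction terms match
because the derivative of the form `e_i·` and the commutator of `δ` with contraction share the term
`(e_i·) ∘ Γ` with opposite signs. -/
theorem isFrameDerivation_frameDerivation (a : TangentSpace (𝓡 n) p)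
    (Γ : TangentSpace (𝓡 n) p →ₗ[ℝ] TangentSpace (𝓡 n) p)
    (hΓ : ∀ i j, g.dot p (Γ (coordFrame p i p)) (coordFrame p j p) +
      g.dot p (coordFrame p i p) (Γ (coordFrame p j p)) =
        scalarDeriv a fun x ↦ g.dot x (coordFrame p i x) (coordFrame p j x)) :
    IsFrameDerivation (g := g) a (fun i ↦ Γ (coordFrame p i p)) (frameDerivation g a Γ) where
  one := by
    apply (g.toExterior p).injective
    have h : HasDirDeriv a (expression g p fun _ ↦ 1) 0 :=
      (HasDirDeriv.const 1).congr (.of_forall fun x ↦ by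
        rw [expression, toExterior_one, map_one])
    rw [h.frameDerivation_eq, toExterior_one, exteriorDerivation_one, add_zero, map_zero]
  coordFrame_mul i A hA := by
    obtain ⟨w, hw⟩ := hA.exists_hasDirDeriv a
    apply (g.toExterior p).injective
    -- Compatibility on pairs of frame vectors, rewritten as an identity of linear forms.
    have hθ : (∑ j, scalarDeriv a (fun x ↦ g.dot x (coordFrame p i x) (coordFrame p j x)) •
        (coordBasis (mem_frameDomain_self p)).coord j) =
        g.bilin p (Γ (coordFrame p i p)) + g.bilin p (coordFrame p i p) ∘ₗ Γ := by
      refine (coordBasis (mem_frameDomain_self p)).ext fun k ↦ ?_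
      rw [LinearMap.add_apply, LinearMap.comp_apply]
      conv_rhs => rw [coordBasis_apply]
      refine Eq.trans ?_ (hΓ i k).symm
      simp [Module.Basis.coord_apply, Finsupp.single_apply]
    have hadd (θ : Module.Dual ℝ (TangentSpace (𝓡 n) p)) (B C) :
      contract θ (B + C) = contract θ B + contract θ C := map_add _ _ _
    have hadd' (θ η : Module.Dual ℝ (TangentSpace (𝓡 n) p)) (B) :
      contract (θ + η) B = contract θ B + contract η B := by simp [contract]
    rw [(hw.coordFrame_mul i).frameDerivation_eq, hθ, map_add (g.toExterior p),
      toExterior_ofVector_mul', toExterior_ofVector_mul', toExterior_ofVector_mul',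
      hw.frameDerivation_eq, map_add (exteriorDerivation Γ), exteriorDerivation_ι_mul,
      exteriorDerivation_contract, hadd, hadd', mul_add]
    abel
  add {A B} hA hB := by
    obtain ⟨w, hw⟩ := hA.exists_hasDirDeriv a
    obtain ⟨v, hv⟩ := hB.exists_hasDirDeriv a
    apply (g.toExterior p).injective
    have h : HasDirDeriv a (expression g p fun x ↦ A x + B x) (w + v) :=
      (hw.add hv).congr (.of_forall fun x ↦ by simp only [expression, map_add])
    rw [h.frameDerivation_eq, map_add (g.toExterior p), map_add (g.toExterior p),
      hw.frameDerivation_eq, hv.frameDerivation_eq, map_add]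
    abel
  smul {φ A} hφ hA := by
    obtain ⟨w, hw⟩ := hA.exists_hasDirDeriv a
    apply (g.toExterior p).injective
    have h : HasDirDeriv a (expression g p fun x ↦ φ x • A x)
        (scalarDeriv a φ • expression g p A p + φ p • w) :=
      (hw.smul hφ.mdifferentiableAt).congr
        (.of_forall fun x ↦ by simp only [expression, map_smul])
    rw [h.frameDerivation_eq, map_add (g.toExterior p), map_smul, map_smul, map_smul, map_smul,
      hw.frameDerivation_eq, expression_self, smul_add, add_assoc]
  congr {A B} hA h := by
    obtain ⟨w, hw⟩ := hA.exists_hasDirDeriv a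
    apply (g.toExterior p).injective
    have h' : HasDirDeriv a (expression g p B) w := hw.congr (by
      filter_upwards [h] with x hx
      rw [expression, expression, hx])
    rw [h'.frameDerivation_eq, hw.frameDerivation_eq, h.self_of_nhds]

namespace IsFrameDerivation

variable {a : TangentSpace (𝓡 n) p} {c : Fin n → TangentSpace (𝓡 n) p}
  {d : ((x : M) → g.Multivector x) → g.Multivector p}

theorem scalar (hd : IsFrameDerivation a c d) {φ : M → ℝ} (hφ : SmoothScalarNear (n := n) p φ) :
    d (fun x ↦ algebraMap ℝ _ (φ x)) = algebraMap ℝ _ (scalarDeriv a φ) := by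
  simp only [Algebra.algebraMap_eq_smul_one]
  rw [hd.smul hφ Generated.one.smooth, hd.one, smul_zero, add_zero]

theorem vector (hd : IsFrameDerivation a c d) {u : (x : M) → TangentSpace (𝓡 n) x}
    {f : Fin n → M → ℝ} (hf : ∀ i, SmoothScalarNear (n := n) p (f i))
    (hu : ∀ᶠ x in 𝓝 p, u x = ∑ i, f i x • coordFrame p i x) :
    d (fun x ↦ g.ofVector x (u x)) =
      g.ofVector p (∑ i, (scalarDeriv a (f i) • coordFrame p i p + f i p • c i)) := by
  have he (i : Fin n) : SmoothMultivectorNear g p fun x ↦ g.ofVector x (coordFrame p i x) :=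
    (SmoothVectorNear.coordFrame i).toMultivector
  have hde (i : Fin n) : d (fun x ↦ g.ofVector x (coordFrame p i x)) = g.ofVector p (c i) := by
    have h := hd.coordFrame_mul i Generated.one.smooth
    simpa only [mul_one, hd.one, mul_zero, add_zero] using h
  have hs (s : Finset (Fin n)) :
      SmoothMultivectorNear g p (fun x ↦ ∑ i ∈ s, f i x • g.ofVector x (coordFrame p i x)) ∧
      d (fun x ↦ ∑ i ∈ s, f i x • g.ofVector x (coordFrame p i x)) =
        g.ofVector p (∑ i ∈ s, (scalarDeriv a (f i) • coordFrame p i p + f i p • c i)) := by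
    classical
    refine ⟨.sum s fun i _ ↦ (he i).smul (hf i), ?_⟩
    induction s using Finset.induction_on with
    | empty =>
      simp only [Finset.sum_empty, map_zero]
      have h := hd.smul (SmoothScalarNear.const 0) (Generated.one (g := g) (p := p)).smooth
      simpa only [zero_smul, hd.one, scalarDeriv_const, smul_zero, add_zero] using h
    | insert i s hi ih =>
      simp only [Finset.sum_insert hi]
      rw [hd.add ((he i).smul (hf i)) (.sum s fun i _ ↦ (he i).smul (hf i)), ih,
        hd.smul (hf i) (he i), hde]
      simp only [map_add, map_smul]
  rw [← (hs Finset.univ).2]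
  refine hd.congr (hs Finset.univ).1 ?_
  filter_upwards [hu] with x hx
  rw [hx]
  simp only [map_sum, map_smul]

/-- By associativity, induction on the left factor reduces the full product rule to left
multiplication by coordinate fields. -/
theorem mul (hd : IsFrameDerivation a c d) {A B : (x : M) → g.Multivector x}
    (hA : SmoothMultivectorNear g p A) (hB : SmoothMultivectorNear g p B) :
    d (fun x ↦ A x * B x) = d A * B p + A p * d B := by
  replace hA := hA.generated
  induction hA with
  | one => simp only [one_mul, hd.one, zero_mul, zero_add]
  | mul i hA ih =>
    simp only [mul_assoc]
    rw [hd.coordFrame_mul i (hA.smooth.mul hB), hd.coordFrame_mul i hA.smooth, ih]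
    simp only [add_mul, mul_add, mul_assoc, add_assoc]
  | add hA hA' ih ih' =>
    simp only [add_mul]
    rw [hd.add (hA.smooth.mul hB) (hA'.smooth.mul hB), hd.add hA.smooth hA'.smooth, ih,
      ih', add_mul]
    abel
  | smul hφ hA ih =>
    simp only [smul_mul_assoc]
    rw [hd.smul hφ (hA.smooth.mul hB), hd.smul hφ hA.smooth, ih]
    simp only [add_mul, smul_mul_assoc, smul_add, add_assoc]
  | congr hA h ih =>
    rw [hd.congr hA.smooth h, h.self_of_nhds, ← ih]
    refine hd.congr (hA.smooth.mul hB) ?_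
    filter_upwards [h] with x hx
    rw [hx]

/-- The determining rules are linear in the pair of direction and frame derivatives, so the claim
follows by induction over the generators. -/
theorem linear_direction {a' : TangentSpace (𝓡 n) p} {c' : Fin n → TangentSpace (𝓡 n) p}
    {α β : ℝ} {d' d'' : ((x : M) → g.Multivector x) → g.Multivector p}
    (hd : IsFrameDerivation a c d) (hd' : IsFrameDerivation a' c' d')
    (hd'' : IsFrameDerivation (α • a + β • a') (fun i ↦ α • c i + β • c' i) d'')
    {A : (x : M) → g.Multivector x} (hA : SmoothMultivectorNear g p A) :
    d'' A = α • d A + β • d' A := by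
  replace hA := hA.generated
  induction hA with
  | one => simp only [hd.one, hd'.one, hd''.one, smul_zero, add_zero]
  | mul i hA ih =>
    rw [hd.coordFrame_mul i hA.smooth, hd'.coordFrame_mul i hA.smooth,
      hd''.coordFrame_mul i hA.smooth, ih]
    simp only [map_add, map_smul, add_mul, mul_add, smul_add, smul_mul_assoc, mul_smul_comm]
    abel
  | add hA hB ih ih' =>
    rw [hd.add hA.smooth hB.smooth, hd'.add hA.smooth hB.smooth, hd''.add hA.smooth hB.smooth,
      ih, ih']
    simp only [smul_add]
    abel
  | smul hφ hA ih =>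
    rw [hd.smul hφ hA.smooth, hd'.smul hφ hA.smooth, hd''.smul hφ hA.smooth, ih]
    simp only [scalarDeriv, map_add, map_smul, smul_eq_mul]
    module
  | congr hA h ih =>
    rw [hd.congr hA.smooth h, hd'.congr hA.smooth h, hd''.congr hA.smooth h, ih]

end IsFrameDerivation

/-- The linear map which sends the coordinate vectors at `p` to the derivatives of the coordinate
vector fields in the direction `a`. -/
def connectionMap (D : VectorOperator n M) (p : M) (a : TangentSpace (𝓡 n) p) :
    TangentSpace (𝓡 n) p →ₗ[ℝ] TangentSpace (𝓡 n) p :=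
  (coordBasis (mem_frameDomain_self p)).constr ℝ fun i ↦ D p a (coordField p i)

theorem connectionMap_coordFrame (D : VectorOperator n M) (a : TangentSpace (𝓡 n) p)
    (i : Fin n) : connectionMap D p a (coordFrame p i p) = D p a (coordField p i) := by
  rw [← coordBasis_apply (mem_frameDomain_self p), connectionMap, Module.Basis.constr_basis]

/-- The extension of a connection to multivector fields. -/
def extendToMultivectors (g : PseudoRiemannianMetric n M) (D : VectorOperator n M) :
    MultivectorOperator g :=
  fun p a A ↦ frameDerivation g a (connectionMap D p a) A.1

variable {D : VectorOperator n M}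

theorem IsMetricCompatible.isFrameDerivation (hD : IsMetricCompatible g D)
    (a : TangentSpace (𝓡 n) p) :
    IsFrameDerivation (g := g) a (fun i ↦ D p a (coordField p i))
      (frameDerivation g a (connectionMap D p a)) := by
  have h := isFrameDerivation_frameDerivation (g := g) a (connectionMap D p a) fun i j ↦ by
    rw [connectionMap_coordFrame, connectionMap_coordFrame]
    exact hD p a (coordField p i) (coordField p j)
  simpa only [connectionMap_coordFrame] using h

/-- Both sides are given by the same coordinate formula in the coefficients of `u`. -/
theorem extendToMultivectors_vectorField (hD : IsAffineConnection D)
    (hg : IsMetricCompatible g D) (a : TangentSpace (𝓡 n) p)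
    (u : smoothVectorFields (n := n) p) :
    extendToMultivectors g D p a (vectorField g u) = g.ofVector p (D p a u) := by
  obtain ⟨f, hf, hu⟩ := SmoothVectorNear.exists_coeff u.2
  rw [hD.eq_sum a hf hu]
  exact (hg.isFrameDerivation a).vector hf hu

theorem isMDD_extendToMultivectors (hD : IsAffineConnection D) (hg : IsMetricCompatible g D) :
    IsMDD g (extendToMultivectors g D) where
  linear_direction p a b α β A := by
    have h := hg.isFrameDerivation (p := p) (α • a + β • b)
    -- Linearity of the connection in the direction puts the frame derivatives into the form that
    -- `IsFrameDerivation.linear_direction` expects.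
    simp only [hD.linear_direction] at h
    exact (hg.isFrameDerivation a).linear_direction (hg.isFrameDerivation b) h A.2
  scalar p a φ hφ := (hg.isFrameDerivation a).scalar hφ
  vector p a u := by
    rw [extendToMultivectors_vectorField hD hg, g.vectorPart_ofVector]
  add p a A B := (hg.isFrameDerivation a).add A.2 B.2
  mul p a A B := (hg.isFrameDerivation a).mul A.2 B.2

theorem restrict_extendToMultivectors (hD : IsAffineConnection D)
    (hg : IsMetricCompatible g D) : restrictToVectors g (extendToMultivectors g D) = D := by
  funext p a u
  rw [restrictToVectors, extendToMultivectors_vectorField hD hg, g.vectorPart_ofVector]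

end FrameDerivation

end GeometricCalculus

end

/-! ### The two bijections -/

theorem mainTheorem2 {n : ℕ} {M : Type*} [TopologicalSpace M]
    [ChartedSpace (EuclideanSpace ℝ (Fin n)) M] [IsManifold (𝓡 n) ∞ M]
    (g : PseudoRiemannianMetric n M) :
    Set.BijOn (restrictToVectors g)
      {D : MultivectorOperator g | IsMDD g D}
      {D : VectorOperator n M | IsAffineConnection D ∧ IsMetricCompatible g D} ∧
    Set.BijOn (restrictToVectors g)
      {D : MultivectorOperator g | IsMDD g D ∧ MultivectorOperator.IsSmooth D}
      {D : VectorOperator n M |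
        IsAffineConnection D ∧ IsMetricCompatible g D ∧ VectorOperator.IsSmooth D} := by
  refine ⟨⟨fun D hD ↦ ⟨hD.isAffineConnection, hD.isMetricCompatible⟩,
    fun D hD D' hD' h ↦ hD.eq_of_restrict_eq hD' h,
    fun D hD ↦ ⟨extendToMultivectors g D, isMDD_extendToMultivectors hD.1 hD.2,
      restrict_extendToMultivectors hD.1 hD.2⟩⟩,
    ⟨fun D hD ↦ ⟨hD.1.isAffineConnection, hD.1.isMetricCompatible, hD.2.restrictToVectors⟩,
    fun D hD D' hD' h ↦ hD.1.eq_of_restrict_eq hD'.1 h, fun D hD ↦ ?_⟩⟩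
  -- The same extension serves the smooth case: it is smooth because its restriction, the given
  -- connection, is.
  have h := isMDD_extendToMultivectors hD.1 hD.2.1
  have hr := restrict_extendToMultivectors hD.1 hD.2.1
  exact ⟨extendToMultivectors g D, ⟨h, h.isSmooth_of_restrict (hr.symm ▸ hD.2.2)⟩, hr⟩
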